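/- Let $E=\mathbb{R}^3(t,x,y)\times\mathbb{R}^2(u,v)$, regarded as a bundle $\pi:E\to\mathbb{R}^3$, and let $J^2\pi$ be its second jet space. The modified Manakov--Santini system is $$F_1=(u_t+uu_y+vu_x)_x-(u_y)_y=0,\qquad F_2=(v_t+vv_x-uv_y)_x-(v_y-2uv_x)_y=0,$$ regarded as the subset $\mathcal{E}_2=\{F_1=F_2=0\}\subset J^2\pi$. A smooth vector field $X$ on $E$ is a point symmetry of the system if its prolongation $X^{(2)}$ to $J^2\pi$ satisfies $(L_{X^{(2)}}F_i)|_{\mathcal{E}_2}=0$ for $i=1,2$. Then: 1. The point symmetries form a Lie algebra $\mathfrak{g}$ under the Lie bracket of vector fields. As a vector space, $\mathfrak{g}$ is spanned by the following vector fields, where $a,b,c,d,e$ are arbitrary smooth functions of $t\in\mathbb{R}$ and a dot denotes $d/dt$: $$\begin{aligned} X_1(a)&=a\,\partial_x+\dot a\,\partial_v,\\ X_2(b)&=b\,\partial_y+\dot b\,\partial_u,\\ X_3(c)&=yc\,\partial_x-2c\,\partial_u+(uc+y\dot c)\,\partial_v,\\ X_4(d)&=d\,\partial_t+\tfrac12\dot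 d\,y\,\partial_y+\tfrac12(y\ddot d-u\dot d)\,\partial_u-\dot d\,v\,\partial_v,\\ X_5(e)&=(y^2\dot e+2xe)\,\partial_x+ye\,\partial_y+(ue-3y\dot e)\,\partial_u+(y^2\ddot e+2yu\dot e+2ve+2x\dot e)\,\partial_v. \end{aligned}$$ 2. For all smooth functions $f,g$ of $t$ the commutators are $$\begin{aligned} &[X_1(f),X_1(g)]=[X_1(f),X_2(g)]=[X_1(f),X_3(g)]=0,\\ &[X_1(f),X_4(g)]=X_1(-g\dot f),\qquad [X_1(f),X_5(g)]=X_1(2fg),\\ &[X_2(f),X_2(g)]=0,\qquad [X_2(f),X_3(g)]=X_1(fg),\\ &[X_2(f),X_4(g)]=X_2(\tfrac12 f\dot g-g\dot f),\qquad [X_2(f),X_5(g)]=X_2(fg)+X_3(2f\dot g),\\ &[X_3(f),X_3(g)]=0,\qquad [X_3(f),X_4(g)]=X_3(-g\dot f-\tfrac12 f\dot g),\qquad [X_3(f),X_5(g)]=X_3(fg),\\ &[X_4(f),X_4(g)]=X_4(f\dot g-g\dot f),\qquad [X_4(f),X_5(g)]=X_5(f\dot g),\qquad [X_5(f),X_5(g)]=0.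 \end{aligned}$$ 3. The Lie algebra $\mathfrak{g}$ is perfect, i.e. $[\mathfrak{g},\mathfrak{g}]=\mathfrak{g}$. 4. Let $\mathfrak{g}_0$ be the span of all $X_4(d)$ and $X_5(e)$, let $\mathfrak{g}_1$ be the span of all $X_2(b)$ and $X_3(c)$, let $\mathfrak{g}_2$ be the span of all $X_1(a)$, and let $\mathfrak{g}_i=0$ for all other integers $i$. Then $\mathfrak{g}=\bigoplus_i\mathfrak{g}_i$ and $[\mathfrak{g}_i,\mathfrak{g}_j]\subset\mathfrak{g}_{i+j}$ for all integers $i,j$. -/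

import Mathlib

open scoped ContDiff

noncomputable section

namespace ManakovSantini

/-! ### Jet coordinates

The base `M = ℝ³` has coordinates `(t, x, y)` (indices `0, 1, 2` of `Fin 3`), the fibre `ℝ²` has
coordinates `(u, v)` (indices `0, 1` of `Fin 2`). -/

/-- The total space `E = J⁰π = ℝ³(t,x,y) × ℝ²(u,v)`. -/
abbrev E : Type := (Fin 3 → ℝ) × (Fin 2 → ℝ)

/-- The first jet space `J¹π`: a point of `E` and the first order coordinates `u_i`, `v_i`. -/
abbrev J1 : Type := E × (Fin 2 → Fin 3 → ℝ)

/-- The second jet space `J²π`: a point of `J¹π` and the second order coordinates `u_{ij}`,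
`v_{ij}`, indexed by unordered pairs `s(i, j)` of base indices. -/
abbrev J2 : Type := J1 × (Fin 2 → Sym2 (Fin 3) → ℝ)

/-- The `i`-th coordinate vector of the base. -/
abbrev baseVec (i : Fin 3) : Fin 3 → ℝ := Pi.single i 1

/-- The truncated total derivative `D_i = ∂_i + ∑_a u^a_i ∂_{u^a}`, from functions on `E` to
functions on `J¹π`. -/
def totalDeriv0 (i : Fin 3) (f : E → ℝ) (θ : J1) : ℝ :=
  fderiv ℝ f θ.1 (baseVec i, fun a => θ.2 a i)

/-- The truncated total derivative `D_i = ∂_i + ∑_a u^a_i ∂_{u^a} + ∑_{a,j} u^a_{ij} ∂_{u^a_j}`,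
from functions on `J¹π` to functions on `J²π`. -/
def totalDeriv1 (i : Fin 3) (f : J1 → ℝ) (θ : J2) : ℝ :=
  fderiv ℝ f θ.1 ((baseVec i, fun a => θ.1.2 a i), fun a j => θ.2 a s(i, j))

/-! ### The modified Manakov–Santini system -/

/-- `F₁ = (u_t + u u_y + v u_x)_x - (u_y)_y` as a function on `J²π`. -/
def F1 : J2 → ℝ := fun θ =>
  totalDeriv1 1 (fun η => η.2 0 0 + η.1.2 0 * η.2 0 2 + η.1.2 1 * η.2 0 1) θ
    - totalDeriv1 2 (fun η => η.2 0 2) θ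

/-- `F₂ = (v_t + v v_x - u v_y)_x - (v_y - 2 u v_x)_y` as a function on `J²π`. -/
def F2 : J2 → ℝ := fun θ =>
  totalDeriv1 1 (fun η => η.2 1 0 + η.1.2 1 * η.2 1 1 - η.1.2 0 * η.2 1 2) θ
    - totalDeriv1 2 (fun η => η.2 1 2 - 2 * η.1.2 0 * η.2 1 1) θ

/-- The equation `{F₁ = F₂ = 0} ⊆ J²π`. -/
def equation : Set J2 := {θ | F1 θ = 0 ∧ F2 θ = 0}

/-! ### Prolongation and point symmetries -/

/-- The prolongation `X⁽¹⁾` to `J¹π` of a vector field `X = ∑ ξ^k ∂_k + ∑ η^a ∂_{u^a}` on `E`: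
its `∂_{u^a_i}`-coefficient is `η^a_i = D_i η^a - ∑_k u^a_k D_i ξ^k`. -/
def prolong1 (X : E → E) (θ : J1) : J1 :=
  (X θ.1, fun a i => totalDeriv0 i (fun p => (X p).2 a) θ
    - ∑ k, θ.2 a k * totalDeriv0 i (fun p => (X p).1 k) θ)

/-- The prolongation `X⁽²⁾` to `J²π`: its `∂_{u^a_{ij}}`-coefficient is
`D_j η^a_i - ∑_k u^a_{ik} D_j ξ^k`, which is symmetric in `i`, `j`; the unordered pair is read
with `i ≤ j`. -/
def prolong2 (X : E → E) (θ : J2) : J2 :=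
  (prolong1 X θ.1, fun a q => totalDeriv1 q.sup (fun η => (prolong1 X η).2 a q.inf) θ
    - ∑ k, θ.2 a s(q.inf, k) * totalDeriv0 q.sup (fun p => (X p).1 k) θ.1)

/-- A vector field `X` on `E` is an infinitesimal point symmetry if `X⁽²⁾` is tangent to the
equation: the Lie derivatives of `F₁`, `F₂` along `X⁽²⁾` vanish on `{F₁ = F₂ = 0}`. -/
def IsPointSymmetry (X : E → E) : Prop :=
  ∀ θ ∈ equation, fderiv ℝ F1 θ (prolong2 X θ) = 0 ∧ fderiv ℝ F2 θ (prolong2 X θ) = 0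

/-! ### The Lie algebra of smooth vector fields on `E` -/

/-- The smooth vector fields on `E`. -/
def smoothVF : Submodule ℝ (E → E) where
  carrier := {X | ContDiff ℝ ∞ X}
  add_mem' {X Y} (hX : ContDiff ℝ ∞ X) (hY : ContDiff ℝ ∞ Y) := hX.add hY
  zero_mem' := (contDiff_const : ContDiff ℝ ∞ fun _ : E => (0 : E))
  smul_mem' _ X (hX : ContDiff ℝ ∞ X) := contDiff_const.smul hX

/-- The type of smooth vector fields on `E`. -/
abbrev VF : Type := smoothVF

lemma VF.contDiff (X : VF) : ContDiff ℝ ∞ X.1 := X.2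

lemma VF.differentiableAt (X : VF) (p : E) : DifferentiableAt ℝ X.1 p :=
  (X.contDiff.differentiable (by simp)).differentiableAt

/-- The bracket `[X, Y]` is the usual Lie bracket of vector fields,
`[X, Y]^k = ∑_l (X^l ∂_l Y^k - Y^l ∂_l X^k)`. -/
instance : Bracket VF VF where
  bracket X Y := ⟨VectorField.lieBracket ℝ X.1 Y.1,
    ContDiff.lieBracket_vectorField (m := ∞) (n := ∞) X.contDiff Y.contDiff le_rfl⟩

lemma VF.coe_bracket (X Y : VF) : (⁅X, Y⁆ : VF).1 = VectorField.lieBracket ℝ X.1 Y.1 := rfl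

instance : LieRing VF where
  add_lie X Y Z := by
    apply Subtype.ext; funext p
    exact VectorField.lieBracket_add_left (X.differentiableAt p) (Y.differentiableAt p)
  lie_add X Y Z := by
    apply Subtype.ext; funext p
    exact VectorField.lieBracket_add_right (Y.differentiableAt p) (Z.differentiableAt p)
  lie_self X := by
    apply Subtype.ext
    exact VectorField.lieBracket_self
  leibniz_lie X Y Z := by
    apply Subtype.ext; funext p
    exact VectorField.leibniz_identity_lieBracket (n := ∞) (by simpa using WithTop.coe_le_coe.2 (le_top : (2 : ℕ∞) ≤ ⊤))
      X.contDiff.contDiffAt Y.contDiff.contDiffAt Z.contDiff.contDiffAt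

instance : LieAlgebra ℝ VF where
  lie_smul c X Y := by
    apply Subtype.ext; funext p
    exact VectorField.lieBracket_const_smul_right (Y.differentiableAt p)

/-! ### Smooth functions of `t` and the five families -/

/-- The algebra `C^∞(ℝ)` of smooth functions of `t`. -/
def smoothFun : Subalgebra ℝ (ℝ → ℝ) where
  carrier := {f | ContDiff ℝ ∞ f}
  mul_mem' {f g} (hf : ContDiff ℝ ∞ f) (hg : ContDiff ℝ ∞ g) := hf.mul hg
  add_mem' {f g} (hf : ContDiff ℝ ∞ f) (hg : ContDiff ℝ ∞ g) := hf.add hg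
  algebraMap_mem' c := (contDiff_const : ContDiff ℝ ∞ fun _ : ℝ => c)

/-- The type of smooth functions of `t`. -/
abbrev Fun : Type := smoothFun

lemma Fun.contDiff (f : Fun) : ContDiff ℝ ∞ f.1 := f.2

lemma Fun.differentiableAt (f : Fun) (t : ℝ) : DifferentiableAt ℝ f.1 t :=
  (f.contDiff.differentiable (by simp)).differentiableAt

/-- The derivative `f ↦ ḟ` on smooth functions of `t`. -/
def dot : Fun →ₗ[ℝ] Fun where
  toFun f := ⟨deriv f.1, (contDiff_infty_iff_deriv.1 f.contDiff).2⟩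
  map_add' f g := by
    apply Subtype.ext; funext t
    exact deriv_add (f.differentiableAt t) (g.differentiableAt t)
  map_smul' c f := by
    apply Subtype.ext; funext t
    exact deriv_const_smul c (f.differentiableAt t)

/-- The coordinate `t` on `E`. -/
abbrev tc (p : E) : ℝ := p.1 0
/-- The coordinate `x` on `E`. -/
abbrev xc (p : E) : ℝ := p.1 1
/-- The coordinate `y` on `E`. -/
abbrev yc (p : E) : ℝ := p.1 2
/-- The coordinate `u` on `E`. -/
abbrev uc (p : E) : ℝ := p.2 0
/-- The coordinate `v` on `E`. -/
abbrev vc (p : E) : ℝ := p.2 1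

lemma contDiff_components {α β γ μ ν : E → ℝ} (hα : ContDiff ℝ ∞ α) (hβ : ContDiff ℝ ∞ β)
    (hγ : ContDiff ℝ ∞ γ) (hμ : ContDiff ℝ ∞ μ) (hν : ContDiff ℝ ∞ ν) :
    ContDiff ℝ ∞ fun p : E => ((![α p, β p, γ p], ![μ p, ν p]) : E) := by
  refine ContDiff.prodMk (contDiff_pi.2 fun i => ?_) (contDiff_pi.2 fun i => ?_)
  · fin_cases i
    exacts [hα, hβ, hγ]
  · fin_cases i
    exacts [hμ, hν]

/-- `X₁(a) = a ∂_x + ȧ ∂_v`. -/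
def X1 : Fun →ₗ[ℝ] VF where
  toFun a := ⟨fun p => (
      ![0,
        a.1 (tc p),
        0],
      ![0,
        (dot a).1 (tc p)]),
    by
      have h0 := a.contDiff
      have h1 := (dot a).contDiff
      generalize (dot a).1 = f1 at h1 ⊢
      generalize a.1 = f0 at h0 ⊢
      exact contDiff_components (by fun_prop) (by fun_prop) (by fun_prop) (by fun_prop)
        (by fun_prop)⟩
  map_add' f g := by
    apply Subtype.ext; funext p
    ext i <;> fin_cases i <;> simp
  map_smul' r f := by
    apply Subtype.ext; funext p
    ext i <;> fin_cases i <;> simp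

/-- `X₂(b) = b ∂_y + ḃ ∂_u`. -/
def X2 : Fun →ₗ[ℝ] VF where
  toFun b := ⟨fun p => (
      ![0,
        0,
        b.1 (tc p)],
      ![(dot b).1 (tc p),
        0]),
    by
      have h0 := b.contDiff
      have h1 := (dot b).contDiff
      generalize (dot b).1 = f1 at h1 ⊢
      generalize b.1 = f0 at h0 ⊢
      exact contDiff_components (by fun_prop) (by fun_prop) (by fun_prop) (by fun_prop)
        (by fun_prop)⟩
  map_add' f g := by
    apply Subtype.ext; funext p
    ext i <;> fin_cases i <;> simp
  map_smul' r f := by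
    apply Subtype.ext; funext p
    ext i <;> fin_cases i <;> simp

/-- `X₃(c) = y c ∂_x - 2 c ∂_u + (u c + y ċ) ∂_v`. -/
def X3 : Fun →ₗ[ℝ] VF where
  toFun c := ⟨fun p => (
      ![0,
        yc p * c.1 (tc p),
        0],
      ![-2 * c.1 (tc p),
        uc p * c.1 (tc p) + yc p * (dot c).1 (tc p)]),
    by
      have h0 := c.contDiff
      have h1 := (dot c).contDiff
      generalize (dot c).1 = f1 at h1 ⊢
      generalize c.1 = f0 at h0 ⊢
      exact contDiff_components (by fun_prop) (by fun_prop) (by fun_prop) (by fun_prop)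
        (by fun_prop)⟩
  map_add' f g := by
    apply Subtype.ext; funext p
    ext i <;> fin_cases i <;> simp <;> ring
  map_smul' r f := by
    apply Subtype.ext; funext p
    ext i <;> fin_cases i <;> simp <;> ring

/-- `X₄(d) = d ∂_t + ½ ḋ y ∂_y + ½ (y d̈ - u ḋ) ∂_u - ḋ v ∂_v`. -/
def X4 : Fun →ₗ[ℝ] VF where
  toFun d := ⟨fun p => (
      ![d.1 (tc p),
        0,
        1 / 2 * (dot d).1 (tc p) * yc p],
      ![1 / 2 * (yc p * (dot (dot d)).1 (tc p) - uc p * (dot d).1 (tc p)),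
        -((dot d).1 (tc p) * vc p)]),
    by
      have h0 := d.contDiff
      have h1 := (dot d).contDiff
      have h2 := (dot (dot d)).contDiff
      generalize (dot (dot d)).1 = f2 at h2 ⊢
      generalize (dot d).1 = f1 at h1 ⊢
      generalize d.1 = f0 at h0 ⊢
      exact contDiff_components (by fun_prop) (by fun_prop) (by fun_prop) (by fun_prop)
        (by fun_prop)⟩
  map_add' f g := by
    apply Subtype.ext; funext p
    ext i <;> fin_cases i <;> simp <;> ring
  map_smul' r f := by
    apply Subtype.ext; funext p
    ext i <;> fin_cases i <;> simp <;> ring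

/-- `X₅(e) = (y² ė + 2 x e) ∂_x + y e ∂_y + (u e - 3 y ė) ∂_u
+ (y² ë + 2 y u ė + 2 v e + 2 x ė) ∂_v`. -/
def X5 : Fun →ₗ[ℝ] VF where
  toFun e := ⟨fun p => (
      ![0,
        yc p ^ 2 * (dot e).1 (tc p) + 2 * xc p * e.1 (tc p),
        yc p * e.1 (tc p)],
      ![uc p * e.1 (tc p) - 3 * yc p * (dot e).1 (tc p),
        yc p ^ 2 * (dot (dot e)).1 (tc p) + 2 * yc p * uc p * (dot e).1 (tc p) + 2 * vc p * e.1 (tc p)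
          + 2 * xc p * (dot e).1 (tc p)]),
    by
      have h0 := e.contDiff
      have h1 := (dot e).contDiff
      have h2 := (dot (dot e)).contDiff
      generalize (dot (dot e)).1 = f2 at h2 ⊢
      generalize (dot e).1 = f1 at h1 ⊢
      generalize e.1 = f0 at h0 ⊢
      exact contDiff_components (by fun_prop) (by fun_prop) (by fun_prop) (by fun_prop)
        (by fun_prop)⟩
  map_add' f g := by
    apply Subtype.ext; funext p
    ext i <;> fin_cases i <;> simp <;> ring
  map_smul' r f := by
    apply Subtype.ext; funext p
    ext i <;> fin_cases i <;> simp <;> ring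

/-- The grading: degree `0` is spanned by `X₄, X₅`, degree `1` by `X₂, X₃`, degree `2` by `X₁`, and
all other degrees vanish. -/
def gradedPart (i : ℤ) : Submodule ℝ VF :=
  if i = 0 then LinearMap.range X4 ⊔ LinearMap.range X5
  else if i = 1 then LinearMap.range X2 ⊔ LinearMap.range X3
  else if i = 2 then LinearMap.range X1
  else ⊥

end ManakovSantini

end

open ManakovSantini

set_option linter.unusedSimpArgs false

noncomputable section

namespace ManakovSantini

/-! Write a point symmetry as T∂_t + X∂_x + Y∂_y + U∂_u + V∂_v. The equations can be solved for u_yy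
and v_yy, so all other jet coordinates are free on the equation manifold. The linearized equations
are polynomial in these coordinates with coefficients built from partial derivatives of T, X, Y, U,
V, and each coefficient must vanish. Instead of comparing polynomials, the proof evaluates at a few
explicit points (`jetPoint`) and takes linear combinations of the resulting identities. The
linearization of F₁ alone already determines everything.

The cascade runs as follows. `symm_T`, `symm_XY` and `symm_Ty` give T = T(t), Y = Y(t,y), X =
X(t,x,y). `IsPointSymmetry.isReduced` gives X_x = 2Y_y - T_t and expresses U and V through T, X, Y.
`IsPointSymmetry.Yyy` makes Y affine in y. After subtracting `X4`, `X5` and `X2` to remove T and Y,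
`IsPointSymmetry.Xyy` makes the remaining X affine in y with no x-dependence, and `X3` and `X1`
absorb it. Nothing is left, because U and V are determined by the base components
(`exists_eq_of_mem_symmetries`). Conversely, the Lie derivatives of F₁ and F₂ along each family are
multiples of F₁ and F₂.

Closure under the bracket is read off from the commutator table. Perfectness follows from the table
and the existence of antiderivatives, since `X4` and `X5` of a derivative are brackets with `X4 1`.
The grading is the eigenspace decomposition of ad `X5 1`, which acts by -i in degree i; this makes
the sum direct. -/

/-! ### Partial derivatives on `E` and rules for total derivatives -/

/-- The directional derivative of `f` along the constant vector field `w`. -/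
def pd (w : E) (f : E → ℝ) (p : E) : ℝ := fderiv ℝ f p w

/-- The `i`-th base coordinate vector of `E`. -/
def eB (i : Fin 3) : E := (baseVec i, 0)

/-- The `a`-th fibre coordinate vector of `E`. -/
def eF (a : Fin 2) : E := (0, Pi.single a 1)

lemma _root_.ContDiff.pd {f : E → ℝ} (hf : ContDiff ℝ ∞ f) (w : E) : ContDiff ℝ ∞ (pd w f) :=
  (hf.fderiv_right (m := ∞) (by simp)).clm_apply contDiff_const

/-- Symmetry of the second derivative. -/
lemma pd_comm {f : E → ℝ} (hf : ContDiff ℝ ∞ f) (v w : E) : pd v (pd w f) = pd w (pd v f) := by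
  funext p
  have hd : DifferentiableAt ℝ (fderiv ℝ f) p :=
    ((hf.fderiv_right (m := ∞) (by simp)).differentiable (by simp)).differentiableAt
  have key : ∀ v w : E, pd v (pd w f) p = fderiv ℝ (fderiv ℝ f) p v w := by
    intro v w
    have : pd w f = fun q => fderiv ℝ f q w := rfl
    rw [this, pd, fderiv_clm_apply hd (by fun_prop)]
    simp
  rw [key, key]
  exact (hf.contDiffAt.isSymmSndFDerivAt
    (by simpa using WithTop.coe_le_coe.2 (le_top : (2 : ℕ∞) ≤ ⊤))).eq v w

lemma jet_direction (i : Fin 3) (q : Fin 2 → Fin 3 → ℝ) :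
    ((baseVec i, fun a => q a i) : E) = eB i + q 0 i • eF 0 + q 1 i • eF 1 := by
  ext k
  · simp [eB, eF]
  · fin_cases k <;> simp [eB, eF]

lemma totalDeriv0_eq (i : Fin 3) (f : E → ℝ) (θ : J1) :
    totalDeriv0 i f θ = pd (eB i) f θ.1 + θ.2 0 i * pd (eF 0) f θ.1 + θ.2 1 i * pd (eF 1) f θ.1 := by
  simp only [totalDeriv0, jet_direction, map_add, map_smul, smul_eq_mul, pd]

lemma totalDeriv1_coord (j : Fin 3) (a : Fin 2) (i : Fin 3) (θ : J2) :
    totalDeriv1 j (fun η => η.2 a i) θ = θ.2 a s(j, i) := by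
  have h : (fun η : J1 => η.2 a i) = ⇑((ContinuousLinearMap.proj (R := ℝ) (φ := fun _ : Fin 3 => ℝ) i).comp
        ((ContinuousLinearMap.proj (R := ℝ) (φ := fun _ : Fin 2 => Fin 3 → ℝ) a).comp
          (ContinuousLinearMap.snd ℝ E (Fin 2 → Fin 3 → ℝ)))) := rfl
  rw [totalDeriv1, h, ContinuousLinearMap.fderiv]
  rfl

lemma totalDeriv1_fst (j : Fin 3) {f : E → ℝ} (θ : J2) (hf : DifferentiableAt ℝ f θ.1.1) :
    totalDeriv1 j (fun η => f η.1) θ = totalDeriv0 j f θ.1 := by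
  have h : HasFDerivAt (fun η : J1 => f η.1) _ θ.1 := hf.hasFDerivAt.comp θ.1 hasFDerivAt_fst
  simp [totalDeriv1, totalDeriv0, h.fderiv]

lemma totalDeriv1_fibre (j : Fin 3) (a : Fin 2) (θ : J2) :
    totalDeriv1 j (fun η => η.1.2 a) θ = θ.1.2 a j := by
  have h : (fun η : J1 => η.1.2 a) = ⇑((ContinuousLinearMap.proj (R := ℝ) (φ := fun _ : Fin 2 => ℝ) a).comp
        ((ContinuousLinearMap.snd ℝ (Fin 3 → ℝ) (Fin 2 → ℝ)).comp
          (ContinuousLinearMap.fst ℝ E (Fin 2 → Fin 3 → ℝ)))) := rfl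
  rw [totalDeriv1, h, ContinuousLinearMap.fderiv]
  rfl

lemma totalDeriv1_add (j : Fin 3) {f g : J1 → ℝ} (θ : J2) (hf : DifferentiableAt ℝ f θ.1)
    (hg : DifferentiableAt ℝ g θ.1) :
    totalDeriv1 j (fun η => f η + g η) θ = totalDeriv1 j f θ + totalDeriv1 j g θ := by
  simp [totalDeriv1, fderiv_fun_add hf hg]

lemma totalDeriv1_sub (j : Fin 3) {f g : J1 → ℝ} (θ : J2) (hf : DifferentiableAt ℝ f θ.1)
    (hg : DifferentiableAt ℝ g θ.1) :
    totalDeriv1 j (fun η => f η - g η) θ = totalDeriv1 j f θ - totalDeriv1 j g θ := by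
  simp [totalDeriv1, fderiv_fun_sub hf hg]

lemma totalDeriv1_mul (j : Fin 3) {f g : J1 → ℝ} (θ : J2) (hf : DifferentiableAt ℝ f θ.1)
    (hg : DifferentiableAt ℝ g θ.1) :
    totalDeriv1 j (fun η => f η * g η) θ = f θ.1 * totalDeriv1 j g θ + g θ.1 * totalDeriv1 j f θ := by
  simp [totalDeriv1, fderiv_fun_mul hf hg]

lemma totalDeriv1_const (j : Fin 3) (c : ℝ) (θ : J2) :
    totalDeriv1 j (fun _ => c) θ = 0 := by
  simp [totalDeriv1]

/-! ### The two equations in jet coordinates and their differentials -/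

lemma F1_eq (θ : J2) :
    F1 θ = θ.2 0 s(0, 1) + θ.1.2 0 1 * θ.1.2 0 2 + θ.1.1.2 0 * θ.2 0 s(1, 2)
      + θ.1.2 1 1 * θ.1.2 0 1 + θ.1.1.2 1 * θ.2 0 s(1, 1) - θ.2 0 s(2, 2) := by
  rw [F1, totalDeriv1_add _ _ (by fun_prop) (by fun_prop), totalDeriv1_add _ _ (by fun_prop) (by fun_prop),
    totalDeriv1_mul _ _ (by fun_prop) (by fun_prop), totalDeriv1_mul _ _ (by fun_prop) (by fun_prop)]
  simp only [totalDeriv1_coord, totalDeriv1_fibre]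
  rw [Sym2.eq_swap (a := (1 : Fin 3)) (b := 0)]
  ring

lemma F2_eq (θ : J2) :
    F2 θ = θ.2 1 s(0, 1) + θ.1.2 1 1 * θ.1.2 1 1 + θ.1.1.2 1 * θ.2 1 s(1, 1)
      - θ.1.2 0 1 * θ.1.2 1 2 + θ.1.1.2 0 * θ.2 1 s(1, 2) - θ.2 1 s(2, 2)
      + 2 * (θ.1.2 0 2 * θ.1.2 1 1) := by
  rw [F2, totalDeriv1_sub _ _ (by fun_prop) (by fun_prop), totalDeriv1_add _ _ (by fun_prop) (by fun_prop),
    totalDeriv1_sub _ _ (by fun_prop) (by fun_prop),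
    totalDeriv1_mul _ _ (by fun_prop) (by fun_prop), totalDeriv1_mul _ _ (by fun_prop) (by fun_prop),
    totalDeriv1_mul _ _ (by fun_prop) (by fun_prop), totalDeriv1_mul _ _ (by fun_prop) (by fun_prop)]
  simp only [totalDeriv1_coord, totalDeriv1_fibre, totalDeriv1_const]
  rw [Sym2.eq_swap (a := (1 : Fin 3)) (b := 0), Sym2.eq_swap (a := (2 : Fin 3)) (b := 1)]
  ring

/-- The second order coordinate functions of `J²π` as continuous linear maps. -/
def coord2 (a : Fin 2) (q : Sym2 (Fin 3)) : J2 →L[ℝ] ℝ :=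
  (ContinuousLinearMap.proj (R := ℝ) (φ := fun _ : Sym2 (Fin 3) => ℝ) q).comp
    ((ContinuousLinearMap.proj (R := ℝ) (φ := fun _ : Fin 2 => Sym2 (Fin 3) → ℝ) a).comp
      (ContinuousLinearMap.snd ℝ J1 (Fin 2 → Sym2 (Fin 3) → ℝ)))

/-- The first order coordinate functions of `J²π` as continuous linear maps. -/
def coord1 (a : Fin 2) (i : Fin 3) : J2 →L[ℝ] ℝ :=
  (ContinuousLinearMap.proj (R := ℝ) (φ := fun _ : Fin 3 => ℝ) i).comp
    ((ContinuousLinearMap.proj (R := ℝ) (φ := fun _ : Fin 2 => Fin 3 → ℝ) a).comp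
      ((ContinuousLinearMap.snd ℝ E (Fin 2 → Fin 3 → ℝ)).comp
        (ContinuousLinearMap.fst ℝ J1 (Fin 2 → Sym2 (Fin 3) → ℝ))))

/-- The fibre coordinate functions of `J²π` as continuous linear maps. -/
def coord0 (a : Fin 2) : J2 →L[ℝ] ℝ :=
  (ContinuousLinearMap.proj (R := ℝ) (φ := fun _ : Fin 2 => ℝ) a).comp
    ((ContinuousLinearMap.snd ℝ (Fin 3 → ℝ) (Fin 2 → ℝ)).comp
      ((ContinuousLinearMap.fst ℝ E (Fin 2 → Fin 3 → ℝ)).comp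
        (ContinuousLinearMap.fst ℝ J1 (Fin 2 → Sym2 (Fin 3) → ℝ))))

lemma coord2_apply (a : Fin 2) (q : Sym2 (Fin 3)) (θ : J2) : coord2 a q θ = θ.2 a q := rfl
lemma coord1_apply (a : Fin 2) (i : Fin 3) (θ : J2) : coord1 a i θ = θ.1.2 a i := rfl
lemma coord0_apply (a : Fin 2) (θ : J2) : coord0 a θ = θ.1.1.2 a := rfl

lemma fderiv_F1 (θ ζ : J2) :
    fderiv ℝ F1 θ ζ = ζ.2 0 s(0, 1) + (ζ.1.2 0 1 * θ.1.2 0 2 + θ.1.2 0 1 * ζ.1.2 0 2)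
      + (ζ.1.1.2 0 * θ.2 0 s(1, 2) + θ.1.1.2 0 * ζ.2 0 s(1, 2))
      + (ζ.1.2 1 1 * θ.1.2 0 1 + θ.1.2 1 1 * ζ.1.2 0 1)
      + (ζ.1.1.2 1 * θ.2 0 s(1, 1) + θ.1.1.2 1 * ζ.2 0 s(1, 1)) - ζ.2 0 s(2, 2) := by
  have hF : F1 = fun θ => coord2 0 s(0, 1) θ + coord1 0 1 θ * coord1 0 2 θ
      + coord0 0 θ * coord2 0 s(1, 2) θ
      + coord1 1 1 θ * coord1 0 1 θ + coord0 1 θ * coord2 0 s(1, 1) θ - coord2 0 s(2, 2) θ := by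
    funext θ; exact F1_eq θ
  have c2 : ∀ a q, HasFDerivAt (fun θ => coord2 a q θ) (coord2 a q) θ := fun a q =>
    (coord2 a q).hasFDerivAt
  have c1 : ∀ a i, HasFDerivAt (fun θ => coord1 a i θ) (coord1 a i) θ := fun a i =>
    (coord1 a i).hasFDerivAt
  have c0 : ∀ a, HasFDerivAt (fun θ => coord0 a θ) (coord0 a) θ := fun a => (coord0 a).hasFDerivAt
  have h := (((((c2 0 s(0, 1)).fun_add ((c1 0 1).fun_mul (c1 0 2))).fun_add
    ((c0 0).fun_mul (c2 0 s(1, 2)))).fun_add ((c1 1 1).fun_mul (c1 0 1))).fun_add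
    ((c0 1).fun_mul (c2 0 s(1, 1)))).fun_sub (c2 0 s(2, 2))
  rw [hF, h.fderiv]
  simp only [_root_.add_apply, _root_.sub_apply,
    _root_.smul_apply, coord2_apply, coord1_apply, coord0_apply, smul_eq_mul]
  ring

lemma fderiv_F2 (θ ζ : J2) :
    fderiv ℝ F2 θ ζ = ζ.2 1 s(0, 1) + 2 * θ.1.2 1 1 * ζ.1.2 1 1
      + (ζ.1.1.2 1 * θ.2 1 s(1, 1) + θ.1.1.2 1 * ζ.2 1 s(1, 1))
      - (ζ.1.2 0 1 * θ.1.2 1 2 + θ.1.2 0 1 * ζ.1.2 1 2)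
      + (ζ.1.1.2 0 * θ.2 1 s(1, 2) + θ.1.1.2 0 * ζ.2 1 s(1, 2)) - ζ.2 1 s(2, 2)
      + 2 * (ζ.1.2 0 2 * θ.1.2 1 1 + θ.1.2 0 2 * ζ.1.2 1 1) := by
  have hF : F2 = fun θ => coord2 1 s(0, 1) θ + coord1 1 1 θ * coord1 1 1 θ
      + coord0 1 θ * coord2 1 s(1, 1) θ - coord1 0 1 θ * coord1 1 2 θ
      + coord0 0 θ * coord2 1 s(1, 2) θ - coord2 1 s(2, 2) θ
      + 2 * (coord1 0 2 θ * coord1 1 1 θ) := by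
    funext θ; exact F2_eq θ
  have c2 : ∀ a q, HasFDerivAt (fun θ => coord2 a q θ) (coord2 a q) θ := fun a q =>
    (coord2 a q).hasFDerivAt
  have c1 : ∀ a i, HasFDerivAt (fun θ => coord1 a i θ) (coord1 a i) θ := fun a i =>
    (coord1 a i).hasFDerivAt
  have c0 : ∀ a, HasFDerivAt (fun θ => coord0 a θ) (coord0 a) θ := fun a => (coord0 a).hasFDerivAt
  have h := ((((((c2 1 s(0, 1)).fun_add ((c1 1 1).fun_mul (c1 1 1))).fun_add
    ((c0 1).fun_mul (c2 1 s(1, 1)))).fun_sub ((c1 0 1).fun_mul (c1 1 2))).fun_add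
    ((c0 0).fun_mul (c2 1 s(1, 2)))).fun_sub (c2 1 s(2, 2))).fun_add
    (((c1 0 2).fun_mul (c1 1 1)).const_mul 2)
  rw [hF, h.fderiv]
  simp only [_root_.add_apply, _root_.sub_apply,
    _root_.smul_apply, coord2_apply, coord1_apply, coord0_apply, smul_eq_mul]
  ring

/-! ### Coefficients of the prolonged field -/

/-- Product rule: the first order coordinates inside D_i f differentiate to second order ones. With
this, every prolongation coefficient becomes a polynomial in the jet coordinates whose coefficients
are partial derivatives on `E`. -/
lemma totalDeriv1_totalDeriv0 {f : E → ℝ} (hf : ContDiff ℝ ∞ f) (i j : Fin 3) (θ : J2) :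
    totalDeriv1 j (totalDeriv0 i f) θ = totalDeriv0 j (pd (eB i) f) θ.1
      + (θ.1.2 0 i * totalDeriv0 j (pd (eF 0) f) θ.1 + θ.2 0 s(i, j) * pd (eF 0) f θ.1.1)
      + (θ.1.2 1 i * totalDeriv0 j (pd (eF 1) f) θ.1 + θ.2 1 s(i, j) * pd (eF 1) f θ.1.1) := by
  have hd : ∀ w, Differentiable ℝ (pd w f) := fun w => (hf.pd w).differentiable (by simp)
  have hB := hd (eB i)
  have h0 := hd (eF 0)
  have h1 := hd (eF 1)
  have : totalDeriv0 i f = fun η => pd (eB i) f η.1 + η.2 0 i * pd (eF 0) f η.1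
      + η.2 1 i * pd (eF 1) f η.1 := funext (totalDeriv0_eq i f)
  rw [this, totalDeriv1_add _ _ (by fun_prop) (by fun_prop),
    totalDeriv1_add _ _ (by fun_prop) (by fun_prop),
    totalDeriv1_mul _ _ (by fun_prop) (by fun_prop), totalDeriv1_mul _ _ (by fun_prop) (by fun_prop),
    totalDeriv1_fst _ _ (hB _), totalDeriv1_fst _ _ (h0 _), totalDeriv1_fst _ _ (h1 _),
    totalDeriv1_coord, totalDeriv1_coord, Sym2.eq_swap (a := j) (b := i)]
  ring

lemma differentiable_totalDeriv0 {f : E → ℝ} (hf : ContDiff ℝ ∞ f) (i : Fin 3) :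
    Differentiable ℝ (totalDeriv0 i f) := by
  have hd : ∀ w, Differentiable ℝ (pd w f) := fun w => (hf.pd w).differentiable (by simp)
  have hB := hd (eB i)
  have h0 := hd (eF 0)
  have h1 := hd (eF 1)
  have : totalDeriv0 i f = fun η => pd (eB i) f η.1 + η.2 0 i * pd (eF 0) f η.1
      + η.2 1 i * pd (eF 1) f η.1 := funext (totalDeriv0_eq i f)
  rw [this]
  fun_prop

lemma contDiff_base {X : E → E} (hX : ContDiff ℝ ∞ X) (k : Fin 3) :
    ContDiff ℝ ∞ fun p => (X p).1 k := by fun_prop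

lemma contDiff_fibre {X : E → E} (hX : ContDiff ℝ ∞ X) (a : Fin 2) :
    ContDiff ℝ ∞ fun p => (X p).2 a := by fun_prop

lemma prolong2_eq {X : E → E} (hX : ContDiff ℝ ∞ X) (θ : J2) (a : Fin 2) {i j : Fin 3} (hij : i ≤ j) :
    (prolong2 X θ).2 a s(i, j) = totalDeriv1 j (totalDeriv0 i fun p => (X p).2 a) θ
      - (θ.1.2 a 0 * totalDeriv1 j (totalDeriv0 i fun p => (X p).1 0) θ
        + θ.1.2 a 1 * totalDeriv1 j (totalDeriv0 i fun p => (X p).1 1) θ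
        + θ.1.2 a 2 * totalDeriv1 j (totalDeriv0 i fun p => (X p).1 2) θ)
      - (θ.2 a s(j, 0) * totalDeriv0 i (fun p => (X p).1 0) θ.1
        + θ.2 a s(j, 1) * totalDeriv0 i (fun p => (X p).1 1) θ.1
        + θ.2 a s(j, 2) * totalDeriv0 i (fun p => (X p).1 2) θ.1)
      - (θ.2 a s(i, 0) * totalDeriv0 j (fun p => (X p).1 0) θ.1
        + θ.2 a s(i, 1) * totalDeriv0 j (fun p => (X p).1 1) θ.1
        + θ.2 a s(i, 2) * totalDeriv0 j (fun p => (X p).1 2) θ.1) := by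
  -- This is where i ≤ j enters: the definition of `prolong2` differentiates along the smaller index
  -- first.
  have hs : (s(i, j)).sup = j := by simpa using hij
  have hi : (s(i, j)).inf = i := by simpa using hij
  have hU := differentiable_totalDeriv0 (contDiff_fibre hX a) i
  have h0 := differentiable_totalDeriv0 (contDiff_base hX 0) i
  have h1 := differentiable_totalDeriv0 (contDiff_base hX 1) i
  have h2 := differentiable_totalDeriv0 (contDiff_base hX 2) i
  simp only [prolong2, hs, hi, prolong1, Fin.sum_univ_three]
  rw [totalDeriv1_sub _ _ (by fun_prop) (by fun_prop),
    totalDeriv1_add _ _ (by fun_prop) (by fun_prop),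
    totalDeriv1_add _ _ (by fun_prop) (by fun_prop),
    totalDeriv1_mul _ _ (by fun_prop) (by fun_prop), totalDeriv1_mul _ _ (by fun_prop) (by fun_prop),
    totalDeriv1_mul _ _ (by fun_prop) (by fun_prop)]
  simp only [totalDeriv1_coord]
  ring

lemma prolong1_eq (X : E → E) (θ : J1) (a : Fin 2) (i : Fin 3) :
    (prolong1 X θ).2 a i = totalDeriv0 i (fun p => (X p).2 a) θ
      - (θ.2 a 0 * totalDeriv0 i (fun p => (X p).1 0) θ
        + θ.2 a 1 * totalDeriv0 i (fun p => (X p).1 1) θ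
        + θ.2 a 2 * totalDeriv0 i (fun p => (X p).1 2) θ) := by
  simp only [prolong1, Fin.sum_univ_three]

/-- The linearization of `F₁` along a prolonged field, in terms of total derivatives on `E`. -/
lemma linearized_F1 (X : E → E) (θ : J2) :
    fderiv ℝ F1 θ (prolong2 X θ) =
      (prolong2 X θ).2 0 s(0, 1)
      + ((prolong1 X θ.1).2 0 1 * θ.1.2 0 2 + θ.1.2 0 1 * (prolong1 X θ.1).2 0 2)
      + ((X θ.1.1).2 0 * θ.2 0 s(1, 2) + θ.1.1.2 0 * (prolong2 X θ).2 0 s(1, 2))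
      + ((prolong1 X θ.1).2 1 1 * θ.1.2 0 1 + θ.1.2 1 1 * (prolong1 X θ.1).2 0 1)
      + ((X θ.1.1).2 1 * θ.2 0 s(1, 1) + θ.1.1.2 1 * (prolong2 X θ).2 0 s(1, 1))
      - (prolong2 X θ).2 0 s(2, 2) := by
  rw [fderiv_F1]; rfl

lemma linearized_F2 (X : E → E) (θ : J2) :
    fderiv ℝ F2 θ (prolong2 X θ) =
      (prolong2 X θ).2 1 s(0, 1) + 2 * θ.1.2 1 1 * (prolong1 X θ.1).2 1 1
      + ((X θ.1.1).2 1 * θ.2 1 s(1, 1) + θ.1.1.2 1 * (prolong2 X θ).2 1 s(1, 1))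
      - ((prolong1 X θ.1).2 0 1 * θ.1.2 1 2 + θ.1.2 0 1 * (prolong1 X θ.1).2 1 2)
      + ((X θ.1.1).2 0 * θ.2 1 s(1, 2) + θ.1.1.2 0 * (prolong2 X θ).2 1 s(1, 2))
      - (prolong2 X θ).2 1 s(2, 2)
      + 2 * ((prolong1 X θ.1).2 0 2 * θ.1.2 1 1 + θ.1.2 0 2 * (prolong1 X θ.1).2 1 1) := by
  rw [fderiv_F2]; rfl

/-! ### First determining equations -/

/-- The point of `J²π` over `p` with the given values of `u_t, u_x, u_y, v_t, v_x, v_y, u_tt, u_tx,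
u_ty, u_xx, u_xy` and `v_tt = v_tx = v_ty = v_xx = v_xy = 0`; the coordinates `u_yy`, `v_yy` are
determined by the equations. -/
def jetPoint (p : E) (ut ux uy vt vx vy utt utx uty uxx uxy : ℝ) : J2 :=
  ((p, ![![ut, ux, uy], ![vt, vx, vy]]),
    fun a s => (![![![utt, utx, uty], ![0, uxx, uxy],
        ![0, 0, utx + ux * uy + p.2 0 * uxy + vx * ux + p.2 1 * uxx]],
      ![![0, 0, 0], ![0, 0, 0], ![0, 0, vx ^ 2 - ux * vy + 2 * uy * vx]]] :
        Fin 2 → Fin 3 → Fin 3 → ℝ) a s.inf s.sup)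

lemma jetPoint_mem (p : E) (ut ux uy vt vx vy utt utx uty uxx uxy : ℝ) :
    jetPoint p ut ux uy vt vx vy utt utx uty uxx uxy ∈ equation := by
  constructor
  · rw [F1_eq]
    simp [jetPoint]
  · rw [F2_eq]
    simp [jetPoint]
    ring

/-- In the linearized F₁ the coordinate u_tt occurs only through the tx-coefficient of the
prolongation, with factor -D_x T = -(T_x + u_x T_u + v_x T_v). -/
lemma symm_T {X : E → E} (hX : ContDiff ℝ ∞ X) (hs : IsPointSymmetry X) (p : E) :
    pd (eB 1) (fun p => (X p).1 0) p = 0 ∧ pd (eF 0) (fun p => (X p).1 0) p = 0 ∧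
      pd (eF 1) (fun p => (X p).1 0) p = 0 := by
  have h := fun ut ux uy vt vx vy utt utx uty uxx uxy =>
    (hs _ (jetPoint_mem p ut ux uy vt vx vy utt utx uty uxx uxy)).1
  simp only [linearized_F1, prolong2_eq hX _ _ (show (0 : Fin 3) ≤ 1 by decide),
    prolong2_eq hX _ _ (show (1 : Fin 3) ≤ 2 by decide), prolong2_eq hX _ _ (le_refl (1 : Fin 3)),
    prolong2_eq hX _ _ (le_refl (2 : Fin 3)), prolong1_eq,
    totalDeriv1_totalDeriv0 (contDiff_base hX _), totalDeriv1_totalDeriv0 (contDiff_fibre hX _),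
    totalDeriv0_eq] at h
  -- Each pair of points differs only in u_tt; the pairs have (u_x, v_x) equal to (0,0), (1,0) and
  -- (0,1).
  have e0 := h 0 0 0 0 0 0 0 0 0 0 0
  have e1 := h 0 0 0 0 0 0 1 0 0 0 0
  have e2 := h 0 1 0 0 0 0 0 0 0 0 0
  have e3 := h 0 1 0 0 0 0 1 0 0 0 0
  have e4 := h 0 0 0 0 1 0 0 0 0 0 0
  have e5 := h 0 0 0 0 1 0 1 0 0 0 0
  simp [jetPoint] at e0 e1 e2 e3 e4 e5
  refine ⟨?_, ?_, ?_⟩ <;> linarith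

lemma pd_zero (w : E) : pd w 0 = 0 := by
  funext p; simp [pd]

/-- Since partial derivatives commute, a vanishing first derivative also removes the mixed second
derivatives from later determining equations. -/
lemma pd_pd_eq_zero {f : E → ℝ} (hf : ContDiff ℝ ∞ f) {z : E} (h : pd z f = 0) (w : E) :
    pd z (pd w f) = 0 := by
  rw [pd_comm hf, h, pd_zero]

/-- At u_x = v_x = 0 the coefficient of u_ty is -Y_x + 2T_y. The coefficients of u_xy and u_xx
depend on u_t and v_t only through -D_t Y and -D_t X, so changing u_t or v_t isolates the u- and
v-derivatives of Y and X. -/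
lemma symm_XY {X : E → E} (hX : ContDiff ℝ ∞ X) (hs : IsPointSymmetry X) (p : E) :
    (pd (eB 1) (fun p => (X p).1 2) p = 2 * pd (eB 2) (fun p => (X p).1 0) p ∧
      pd (eF 0) (fun p => (X p).1 2) p = 0 ∧ pd (eF 1) (fun p => (X p).1 2) p = 0) ∧
    (pd (eF 0) (fun p => (X p).1 1) p = 0 ∧ pd (eF 1) (fun p => (X p).1 1) p = 0) := by
  have hx : pd (eB 1) (fun p => (X p).1 0) = 0 := funext fun p => (symm_T hX hs p).1
  have hu : pd (eF 0) (fun p => (X p).1 0) = 0 := funext fun p => (symm_T hX hs p).2.1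
  have hv : pd (eF 1) (fun p => (X p).1 0) = 0 := funext fun p => (symm_T hX hs p).2.2
  have hx' := pd_pd_eq_zero (contDiff_base hX 0) hx
  have hu' := pd_pd_eq_zero (contDiff_base hX 0) hu
  have hv' := pd_pd_eq_zero (contDiff_base hX 0) hv
  have h := fun ut ux uy vt vx vy utt utx uty uxx uxy =>
    (hs _ (jetPoint_mem p ut ux uy vt vx vy utt utx uty uxx uxy)).1
  simp only [linearized_F1, prolong2_eq hX _ _ (show (0 : Fin 3) ≤ 1 by decide),
    prolong2_eq hX _ _ (show (1 : Fin 3) ≤ 2 by decide), prolong2_eq hX _ _ (le_refl (1 : Fin 3)),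
    prolong2_eq hX _ _ (le_refl (2 : Fin 3)), prolong1_eq,
    totalDeriv1_totalDeriv0 (contDiff_base hX _), totalDeriv1_totalDeriv0 (contDiff_fibre hX _),
    totalDeriv0_eq, hx, hu, hv, hx', hu', hv', pd_zero, Pi.zero_apply] at h
  have e0 := h 0 0 0 0 0 0 0 0 0 0 0
  have e0y := h 0 0 0 0 0 0 0 0 0 0 1
  have e0x := h 0 0 0 0 0 0 0 0 0 1 0
  have e0t := h 0 0 0 0 0 0 0 0 1 0 0
  have e1 := h 1 0 0 0 0 0 0 0 0 0 0
  have e1y := h 1 0 0 0 0 0 0 0 0 0 1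
  have e1x := h 1 0 0 0 0 0 0 0 0 1 0
  have e2 := h 0 0 0 1 0 0 0 0 0 0 0
  have e2y := h 0 0 0 1 0 0 0 0 0 0 1
  have e2x := h 0 0 0 1 0 0 0 0 0 1 0
  simp [jetPoint] at e0 e0y e0x e0t e1 e1y e1x e2 e2y e2x
  refine ⟨⟨?_, ?_, ?_⟩, ?_, ?_⟩ <;> linarith

lemma symm_Ty {X : E → E} (hX : ContDiff ℝ ∞ X) (hs : IsPointSymmetry X) (p : E) :
    pd (eB 2) (fun p => (X p).1 0) p = 0 := by
  have hx : pd (eB 1) (fun p => (X p).1 0) = 0 := funext fun p => (symm_T hX hs p).1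
  have hu : pd (eF 0) (fun p => (X p).1 0) = 0 := funext fun p => (symm_T hX hs p).2.1
  have hv : pd (eF 1) (fun p => (X p).1 0) = 0 := funext fun p => (symm_T hX hs p).2.2
  have hx' := pd_pd_eq_zero (contDiff_base hX 0) hx
  have hu' := pd_pd_eq_zero (contDiff_base hX 0) hu
  have hv' := pd_pd_eq_zero (contDiff_base hX 0) hv
  have hYu : pd (eF 0) (fun p => (X p).1 2) = 0 := funext fun p => (symm_XY hX hs p).1.2.1
  have hYv : pd (eF 1) (fun p => (X p).1 2) = 0 := funext fun p => (symm_XY hX hs p).1.2.2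
  have hYu' := pd_pd_eq_zero (contDiff_base hX 2) hYu
  have hYv' := pd_pd_eq_zero (contDiff_base hX 2) hYv
  have hXu : pd (eF 0) (fun p => (X p).1 1) = 0 := funext fun p => (symm_XY hX hs p).2.1
  have hXv : pd (eF 1) (fun p => (X p).1 1) = 0 := funext fun p => (symm_XY hX hs p).2.2
  have hXu' := pd_pd_eq_zero (contDiff_base hX 1) hXu
  have hXv' := pd_pd_eq_zero (contDiff_base hX 1) hXv
  have hYx := (symm_XY hX hs p).1.1
  have h := fun ut ux uy vt vx vy utt utx uty uxx uxy =>
    (hs _ (jetPoint_mem p ut ux uy vt vx vy utt utx uty uxx uxy)).1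
  simp only [linearized_F1, prolong2_eq hX _ _ (show (0 : Fin 3) ≤ 1 by decide),
    prolong2_eq hX _ _ (show (1 : Fin 3) ≤ 2 by decide), prolong2_eq hX _ _ (le_refl (1 : Fin 3)),
    prolong2_eq hX _ _ (le_refl (2 : Fin 3)), prolong1_eq,
    totalDeriv1_totalDeriv0 (contDiff_base hX _), totalDeriv1_totalDeriv0 (contDiff_fibre hX _),
    totalDeriv0_eq, hx, hu, hv, hx', hu', hv', hYu, hYv, hYu', hYv', hXu, hXv, hXu', hXv',
    pd_zero, Pi.zero_apply] at h
  -- The coefficient of u_t u_x gives U_uu = T_y (`e0` to `e3`), and that of u_y² gives U_uu = -Y_x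
  -- (`e0`, `e4`, `e5`). Since Y_x = 2T_y, this forces 3T_y = 0.
  have e0 := h 0 0 0 0 0 0 0 0 0 0 0
  have e1 := h 1 0 0 0 0 0 0 0 0 0 0
  have e2 := h 0 1 0 0 0 0 0 0 0 0 0
  have e3 := h 1 1 0 0 0 0 0 0 0 0 0
  have e4 := h 0 0 1 0 0 0 0 0 0 0 0
  have e5 := h 0 0 (-1) 0 0 0 0 0 0 0 0
  simp [jetPoint] at e0 e1 e2 e3 e4 e5
  simp only [hYx] at e0 e1 e2 e3 e4 e5
  linarith

/-- Vector fields with projectable base components that determine the fibre components, as the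
linearized equation forces for point symmetries. -/
structure IsReduced (X : E → E) : Prop where
  Tx : pd (eB 1) (fun p => (X p).1 0) = 0
  Ty : pd (eB 2) (fun p => (X p).1 0) = 0
  Tu : pd (eF 0) (fun p => (X p).1 0) = 0
  Tv : pd (eF 1) (fun p => (X p).1 0) = 0
  Xu : pd (eF 0) (fun p => (X p).1 1) = 0
  Xv : pd (eF 1) (fun p => (X p).1 1) = 0
  Yx : pd (eB 1) (fun p => (X p).1 2) = 0
  Yu : pd (eF 0) (fun p => (X p).1 2) = 0
  Yv : pd (eF 1) (fun p => (X p).1 2) = 0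
  Xx : ∀ p, pd (eB 1) (fun p => (X p).1 1) p
    = 2 * pd (eB 2) (fun p => (X p).1 2) p - pd (eB 0) (fun p => (X p).1 0) p
  U : ∀ p, (X p).2 0 = pd (eB 0) (fun p => (X p).1 2) p
    + p.2 0 * (pd (eB 1) (fun p => (X p).1 1) p - pd (eB 2) (fun p => (X p).1 2) p)
    - 2 * pd (eB 2) (fun p => (X p).1 1) p
  V : ∀ p, (X p).2 1 = pd (eB 0) (fun p => (X p).1 1) p
    + p.2 0 * pd (eB 2) (fun p => (X p).1 1) p
    + 2 * p.2 1 * (pd (eB 1) (fun p => (X p).1 1) p - pd (eB 2) (fun p => (X p).1 2) p)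

/-- The last three fields are the coefficients of u_tx, u_xy and u_xx. Eliminating u_yy makes the
U_u contributions of the tx-, xy- and xx-coefficients cancel against those of the yy-coefficient, so
U and V themselves are isolated. -/
lemma IsPointSymmetry.isReduced {X : E → E} (hX : ContDiff ℝ ∞ X) (hs : IsPointSymmetry X) :
    IsReduced X := by
  have hx : pd (eB 1) (fun p => (X p).1 0) = 0 := funext fun p => (symm_T hX hs p).1
  have hy : pd (eB 2) (fun p => (X p).1 0) = 0 := funext fun p => symm_Ty hX hs p
  have hu : pd (eF 0) (fun p => (X p).1 0) = 0 := funext fun p => (symm_T hX hs p).2.1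
  have hv : pd (eF 1) (fun p => (X p).1 0) = 0 := funext fun p => (symm_T hX hs p).2.2
  have hx' := pd_pd_eq_zero (contDiff_base hX 0) hx
  have hu' := pd_pd_eq_zero (contDiff_base hX 0) hu
  have hv' := pd_pd_eq_zero (contDiff_base hX 0) hv
  have hYu : pd (eF 0) (fun p => (X p).1 2) = 0 := funext fun p => (symm_XY hX hs p).1.2.1
  have hYv : pd (eF 1) (fun p => (X p).1 2) = 0 := funext fun p => (symm_XY hX hs p).1.2.2
  have hYx : pd (eB 1) (fun p => (X p).1 2) = 0 := funext fun p => by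
    rw [(symm_XY hX hs p).1.1, hy]; simp
  have hYu' := pd_pd_eq_zero (contDiff_base hX 2) hYu
  have hYv' := pd_pd_eq_zero (contDiff_base hX 2) hYv
  have hXu : pd (eF 0) (fun p => (X p).1 1) = 0 := funext fun p => (symm_XY hX hs p).2.1
  have hXv : pd (eF 1) (fun p => (X p).1 1) = 0 := funext fun p => (symm_XY hX hs p).2.2
  have hXu' := pd_pd_eq_zero (contDiff_base hX 1) hXu
  have hXv' := pd_pd_eq_zero (contDiff_base hX 1) hXv
  have h := fun p ut ux uy vt vx vy utt utx uty uxx uxy =>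
    (hs _ (jetPoint_mem p ut ux uy vt vx vy utt utx uty uxx uxy)).1
  simp only [linearized_F1, prolong2_eq hX _ _ (show (0 : Fin 3) ≤ 1 by decide),
    prolong2_eq hX _ _ (show (1 : Fin 3) ≤ 2 by decide), prolong2_eq hX _ _ (le_refl (1 : Fin 3)),
    prolong2_eq hX _ _ (le_refl (2 : Fin 3)), prolong1_eq,
    totalDeriv1_totalDeriv0 (contDiff_base hX _), totalDeriv1_totalDeriv0 (contDiff_fibre hX _),
    totalDeriv0_eq, hx, hy, hu, hv, hx', hu', hv', hYu, hYv, hYu', hYv', hXu, hXv, hXu', hXv', hYx,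
    pd_zero, Pi.zero_apply] at h
  refine ⟨hx, hy, hu, hv, hXu, hXv, hYx, hYu, hYv, fun p => ?_, fun p => ?_, fun p => ?_⟩
  · have e0 := h p 0 0 0 0 0 0 0 0 0 0 0
    have e1 := h p 0 0 0 0 0 0 0 1 0 0 0
    simp [jetPoint] at e0 e1
    linarith
  · have e0 := h p 0 0 0 0 0 0 0 0 0 0 0
    have e1 := h p 0 0 0 0 0 0 0 0 0 0 1
    simp [jetPoint] at e0 e1
    linarith
  · have e0 := h p 0 0 0 0 0 0 0 0 0 0 0
    have e1 := h p 0 0 0 0 0 0 0 0 0 1 0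
    simp [jetPoint] at e0 e1
    linarith

/-! ### Rules for partial derivatives; functions of t alone -/

lemma pd_const (w : E) (c : ℝ) : pd w (fun _ => c) = fun _ => 0 := by
  funext p; simp [pd]

lemma pd_add (w : E) {f g : E → ℝ} (hf : Differentiable ℝ f) (hg : Differentiable ℝ g) :
    pd w (fun p => f p + g p) = fun p => pd w f p + pd w g p := by
  funext p; simp [pd, fderiv_fun_add (hf p) (hg p)]

lemma pd_sub (w : E) {f g : E → ℝ} (hf : Differentiable ℝ f) (hg : Differentiable ℝ g) :
    pd w (fun p => f p - g p) = fun p => pd w f p - pd w g p := by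
  funext p; simp [pd, fderiv_fun_sub (hf p) (hg p)]

lemma pd_neg (w : E) (f : E → ℝ) : pd w (fun p => -f p) = fun p => -pd w f p := by
  funext p; simp [pd]

lemma pd_mul (w : E) {f g : E → ℝ} (hf : Differentiable ℝ f) (hg : Differentiable ℝ g) :
    pd w (fun p => f p * g p) = fun p => f p * pd w g p + g p * pd w f p := by
  funext p; simp [pd, fderiv_fun_mul (hf p) (hg p)]

lemma pd_base (w : E) (i : Fin 3) : pd w (fun p => p.1 i) = fun _ => w.1 i := by
  funext p
  have h : (fun p : E => p.1 i) = ⇑((ContinuousLinearMap.proj (R := ℝ) (φ := fun _ : Fin 3 => ℝ) i).comp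
    (ContinuousLinearMap.fst ℝ (Fin 3 → ℝ) (Fin 2 → ℝ))) := rfl
  rw [pd, h, ContinuousLinearMap.fderiv]
  rfl

lemma pd_fibre (w : E) (a : Fin 2) : pd w (fun p => p.2 a) = fun _ => w.2 a := by
  funext p
  have h : (fun p : E => p.2 a) = ⇑((ContinuousLinearMap.proj (R := ℝ) (φ := fun _ : Fin 2 => ℝ) a).comp
    (ContinuousLinearMap.snd ℝ (Fin 3 → ℝ) (Fin 2 → ℝ))) := rfl
  rw [pd, h, ContinuousLinearMap.fderiv]
  rfl

/-- A smooth function of `t` as a function on `E`. -/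
def pull (f : Fun) (p : E) : ℝ := f.1 (p.1 0)

@[fun_prop]
lemma differentiable_pull (f : Fun) : Differentiable ℝ (pull f) := by
  have h := f.contDiff.differentiable (by simp)
  unfold pull
  generalize f.1 = g at h
  fun_prop

lemma contDiff_pull (f : Fun) : ContDiff ℝ ∞ (pull f) := by
  have h := f.contDiff
  unfold pull
  generalize f.1 = g at h
  fun_prop

lemma pd_pull (w : E) (f : Fun) : pd w (pull f) = fun p => w.1 0 * pull (dot f) p := by
  funext p
  have h : HasFDerivAt (fun p : E => p.1 0) ((ContinuousLinearMap.proj (R := ℝ) (φ := fun _ : Fin 3 => ℝ) 0).comp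
    (ContinuousLinearMap.fst ℝ (Fin 3 → ℝ) (Fin 2 → ℝ))) p :=
    ((ContinuousLinearMap.proj (R := ℝ) (φ := fun _ : Fin 3 => ℝ) 0).comp
      (ContinuousLinearMap.fst ℝ (Fin 3 → ℝ) (Fin 2 → ℝ))).hasFDerivAt
  have h2 : HasFDerivAt (pull f) _ p :=
    (f.differentiableAt (p.1 0)).hasDerivAt.comp_hasFDerivAt p h
  rw [pd, h2.fderiv]
  simp [pull, dot, mul_comm]

/-- A smooth function on `E` whose derivatives along `x, y, u, v` vanish is a function of `t`. -/
lemma exists_pull {f : E → ℝ} (hf : ContDiff ℝ ∞ f) (hx : pd (eB 1) f = 0) (hy : pd (eB 2) f = 0)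
    (hu : pd (eF 0) f = 0) (hv : pd (eF 1) f = 0) : ∃ g : Fun, f = pull g := by
  have hd : Differentiable ℝ f := hf.differentiable (by simp)
  refine ⟨⟨fun t => f (![t, 0, 0], 0), hf.comp (f := fun t : ℝ => ((![t, 0, 0], 0) : E)) ?_⟩, ?_⟩
  · refine ContDiff.prodMk (contDiff_pi.2 fun i => ?_) contDiff_const
    fin_cases i
    exacts [contDiff_id, contDiff_const, contDiff_const]
  funext p
  set q : E := (![p.1 0, 0, 0], 0) with hq
  -- The segment from `q` to `p` keeps t fixed, so `f` has zero derivative along it and takes equal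
  -- values at the ends.
  have hw : p - q = p.1 1 • eB 1 + p.1 2 • eB 2 + p.2 0 • eF 0 + p.2 1 • eF 1 := by
    ext k <;> fin_cases k <;> simp [hq, eB, eF, baseVec]
  have hz : ∀ r, fderiv ℝ f r (p - q) = 0 := fun r => by
    have h1 : fderiv ℝ f r (eB 1) = 0 := congrFun hx r
    have h2 : fderiv ℝ f r (eB 2) = 0 := congrFun hy r
    have h3 : fderiv ℝ f r (eF 0) = 0 := congrFun hu r
    have h4 : fderiv ℝ f r (eF 1) = 0 := congrFun hv r
    simp [hw, h1, h2, h3, h4]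
  have hl : ∀ s : ℝ, HasDerivAt (fun s : ℝ => q + s • (p - q)) (p - q) s := fun s => by
    simpa using ((hasDerivAt_id s).smul_const (p - q)).const_add q
  have hc : ∀ s : ℝ, HasDerivAt (fun s : ℝ => f (q + s • (p - q))) 0 s := fun s => by
    have := (hd _).hasFDerivAt.comp_hasDerivAt s (hl s)
    rwa [hz] at this
  have := is_const_of_deriv_eq_zero (fun s => (hc s).differentiableAt) (fun s => (hc s).deriv) 1 0
  simpa [pull] using this

/-! ### Second order determining equations -/

lemma IsReduced.Uu {X : E → E} (hX : ContDiff ℝ ∞ X) (h : IsReduced X) :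
    pd (eF 0) (fun p => (X p).2 0) = fun p => pd (eB 1) (fun p => (X p).1 1) p
      - pd (eB 2) (fun p => (X p).1 2) p := by
  have h1 := ((contDiff_base hX 2).pd (eB 0)).differentiable (by simp)
  have h2 := ((contDiff_base hX 2).pd (eB 2)).differentiable (by simp)
  have h3 := ((contDiff_base hX 1).pd (eB 1)).differentiable (by simp)
  have h4 := ((contDiff_base hX 1).pd (eB 2)).differentiable (by simp)
  have hXu := pd_pd_eq_zero (contDiff_base hX 1) h.Xu
  have hYu := pd_pd_eq_zero (contDiff_base hX 2) h.Yu
  rw [show (fun p => (X p).2 0) = _ from funext h.U]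
  simp (disch := fun_prop) only [pd_add, pd_sub, pd_mul, pd_const, pd_fibre, hXu, hYu]
  simp [eF]

/-- The part of the linearized F₁ that is linear in u_y is U_x - 2U_yu + Y_yy. The reduced form
gives U_x = -2X_xy = -4Y_yy and U_yu = X_xy - Y_yy = Y_yy, so the condition reads -5Y_yy = 0. -/
lemma IsPointSymmetry.Yyy {X : E → E} (hX : ContDiff ℝ ∞ X) (hs : IsPointSymmetry X) :
    pd (eB 2) (pd (eB 2) (fun p => (X p).1 2)) = 0 := by
  have h := hs.isReduced hX
  have h1 := ((contDiff_base hX 2).pd (eB 0)).differentiable (by simp)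
  have h2 := ((contDiff_base hX 2).pd (eB 2)).differentiable (by simp)
  have h3 := ((contDiff_base hX 1).pd (eB 1)).differentiable (by simp)
  have h4 := ((contDiff_base hX 1).pd (eB 2)).differentiable (by simp)
  have h5 := ((contDiff_base hX 0).pd (eB 0)).differentiable (by simp)
  have hTx' := pd_pd_eq_zero (contDiff_base hX 0) h.Tx
  have hTy' := pd_pd_eq_zero (contDiff_base hX 0) h.Ty
  have hTu' := pd_pd_eq_zero (contDiff_base hX 0) h.Tu
  have hXu' := pd_pd_eq_zero (contDiff_base hX 1) h.Xu
  have hXv' := pd_pd_eq_zero (contDiff_base hX 1) h.Xv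
  have hYx' := pd_pd_eq_zero (contDiff_base hX 2) h.Yx
  have hYu' := pd_pd_eq_zero (contDiff_base hX 2) h.Yu
  have hXxx : pd (eB 1) (pd (eB 1) (fun p => (X p).1 1)) = 0 := by
    rw [show pd (eB 1) (fun p => (X p).1 1) = _ from funext h.Xx]
    simp (disch := fun_prop) only [pd_sub, pd_mul, pd_const, hYx', hTx']
    funext p; simp
  have hXxy : pd (eB 2) (pd (eB 1) (fun p => (X p).1 1)) =
      fun p => 2 * pd (eB 2) (pd (eB 2) (fun p => (X p).1 2)) p := by
    rw [show pd (eB 1) (fun p => (X p).1 1) = _ from funext h.Xx]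
    simp (disch := fun_prop) only [pd_sub, pd_mul, pd_const, hTy']
    funext p; simp
  have hUx : pd (eB 1) (fun p => (X p).2 0) =
      fun p => -4 * pd (eB 2) (pd (eB 2) (fun p => (X p).1 2)) p := by
    rw [show (fun p => (X p).2 0) = _ from funext h.U]
    simp (disch := fun_prop) only [pd_add, pd_sub, pd_mul, pd_const, pd_fibre, hXxx, hYx',
      pd_comm (contDiff_base hX 1) (eB 1) (eB 2), hXxy]
    funext p; simp [eB]; ring
  have hU := contDiff_fibre hX 0
  have hUu := h.Uu hX
  have hUxu : pd (eB 1) (pd (eF 0) (fun p => (X p).2 0)) = 0 := by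
    rw [hUu]
    simp (disch := fun_prop) only [pd_sub, hXxx, hYx']
    funext p; simp
  have hUyu : pd (eB 2) (pd (eF 0) (fun p => (X p).2 0)) =
      fun p => pd (eB 2) (pd (eB 2) (fun p => (X p).1 2)) p := by
    rw [hUu]
    simp (disch := fun_prop) only [pd_sub, hXxy]
    funext p; ring
  funext p
  have e := fun ut ux uy vt vx vy utt utx uty uxx uxy =>
    (hs _ (jetPoint_mem p ut ux uy vt vx vy utt utx uty uxx uxy)).1
  simp only [linearized_F1, prolong2_eq hX _ _ (show (0 : Fin 3) ≤ 1 by decide),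
    prolong2_eq hX _ _ (show (1 : Fin 3) ≤ 2 by decide), prolong2_eq hX _ _ (le_refl (1 : Fin 3)),
    prolong2_eq hX _ _ (le_refl (2 : Fin 3)), prolong1_eq,
    totalDeriv1_totalDeriv0 (contDiff_base hX _), totalDeriv1_totalDeriv0 (contDiff_fibre hX _),
    totalDeriv0_eq, h.Tx, h.Ty, h.Tu, h.Tv, hTx', hTu', h.Yx, h.Yu, h.Yv, hYx', hYu',
    h.Xu, h.Xv, hXu', hXv', pd_comm hU (eF 0) (eB 2),
    pd_comm hU (eF 0) (eB 1), hUxu, hUyu, pd_zero, Pi.zero_apply] at e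
  -- Subtracting the values at u_y = 1 and u_y = -1 leaves the odd part in u_y.
  have e0 := e 0 0 1 0 0 0 0 0 0 0 0
  have e1 := e 0 0 (-1) 0 0 0 0 0 0 0 0
  simp [jetPoint] at e0 e1
  simp only [hUx] at e0 e1
  simp only [Pi.zero_apply]
  linarith

/-- With T = Y = 0 the reduced form leaves X_x = 0, U = -2X_y and V = X_t + uX_y. The part of the
linearized F₁ linear in u_x is then U_y + V_x + X_yy = -X_yy. -/
lemma IsPointSymmetry.Xyy {X : E → E} (hX : ContDiff ℝ ∞ X) (hs : IsPointSymmetry X)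
    (hT : (fun p => (X p).1 0) = 0) (hY : (fun p => (X p).1 2) = 0) :
    pd (eB 2) (pd (eB 2) (fun p => (X p).1 1)) = 0 := by
  have h := hs.isReduced hX
  have h1 := ((contDiff_base hX 1).pd (eB 0)).differentiable (by simp)
  have h4 := ((contDiff_base hX 1).pd (eB 2)).differentiable (by simp)
  have hXu' := pd_pd_eq_zero (contDiff_base hX 1) h.Xu
  have hXv' := pd_pd_eq_zero (contDiff_base hX 1) h.Xv
  have hXx : pd (eB 1) (fun p => (X p).1 1) = 0 := funext fun p => by
    rw [h.Xx, hT, hY]; simp [pd_zero]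
  have hXx' := pd_pd_eq_zero (contDiff_base hX 1) hXx
  have hUu : pd (eF 0) (fun p => (X p).2 0) = 0 := by
    rw [h.Uu hX, hXx, hY]; funext p; simp [pd_zero]
  have hUu' := pd_pd_eq_zero (contDiff_fibre hX 0) hUu
  have hUy : pd (eB 2) (fun p => (X p).2 0) =
      fun p => -2 * pd (eB 2) (pd (eB 2) (fun p => (X p).1 1)) p := by
    rw [show (fun p => (X p).2 0) = _ from funext h.U, hXx, hY]
    simp (disch := fun_prop) only [pd_sub, pd_add, pd_mul, pd_const, pd_zero, Pi.zero_apply]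
    funext p; simp
  have hVx : pd (eB 1) (fun p => (X p).2 1) = 0 := by
    rw [show (fun p => (X p).2 1) = _ from funext h.V, hXx, hY]
    simp (disch := fun_prop) only [pd_sub, pd_add, pd_mul, pd_const, pd_zero, pd_fibre, Pi.zero_apply,
      hXx']
    funext p; simp [eB]
  funext p
  have e := fun ut ux uy vt vx vy utt utx uty uxx uxy =>
    (hs _ (jetPoint_mem p ut ux uy vt vx vy utt utx uty uxx uxy)).1
  simp only [linearized_F1, prolong2_eq hX _ _ (show (0 : Fin 3) ≤ 1 by decide),
    prolong2_eq hX _ _ (show (1 : Fin 3) ≤ 2 by decide), prolong2_eq hX _ _ (le_refl (1 : Fin 3)),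
    prolong2_eq hX _ _ (le_refl (2 : Fin 3)), prolong1_eq,
    totalDeriv1_totalDeriv0 (contDiff_base hX _), totalDeriv1_totalDeriv0 (contDiff_fibre hX _),
    totalDeriv0_eq, hT, hY, h.Xu, h.Xv, hXu', hXv', hUu, hUu', hUy, hVx, hXx, hXx',
    pd_zero, Pi.zero_apply] at e
  have e0 := e 0 1 0 0 0 0 0 0 0 0 0
  have e1 := e 0 (-1) 0 0 0 0 0 0 0 0 0
  simp [jetPoint] at e0 e1
  simp only [Pi.zero_apply]
  linarith

/-- Both f_y and f - y f_y have vanishing x-, y-, u- and v-derivatives, so `exists_pull` applies to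
each. -/
lemma exists_pull_affine {f : E → ℝ} (hf : ContDiff ℝ ∞ f) (hx : pd (eB 1) f = 0)
    (hyy : pd (eB 2) (pd (eB 2) f) = 0) (hu : pd (eF 0) f = 0) (hv : pd (eF 1) f = 0) :
    ∃ g h : Fun, f = fun p => p.1 2 * pull g p + pull h p := by
  obtain ⟨g, hg⟩ := exists_pull (hf.pd (eB 2)) (pd_pd_eq_zero hf hx _) hyy
    (pd_pd_eq_zero hf hu _) (pd_pd_eq_zero hf hv _)
  have hd := hf.differentiable (by simp)
  have hc := contDiff_pull g
  obtain ⟨h, hh⟩ := exists_pull (f := fun p => f p - p.1 2 * pull g p) (by fun_prop)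
    (by simp (disch := fun_prop) only [pd_sub, pd_mul, pd_base, pd_pull, hx]; funext p; simp [eB])
    (by simp (disch := fun_prop) only [pd_sub, pd_mul, pd_base, pd_pull, hg]; funext p; simp [eB])
    (by simp (disch := fun_prop) only [pd_sub, pd_mul, pd_base, pd_pull, hu]; funext p; simp [eF])
    (by simp (disch := fun_prop) only [pd_sub, pd_mul, pd_base, pd_pull, hv]; funext p; simp [eF])
  refine ⟨g, h, funext fun p => ?_⟩
  have := congrFun hh p
  linarith

/-! ### The symmetries form a linear space -/

lemma pd_add_smul (w : E) {f g : E → ℝ} (hf : ContDiff ℝ ∞ f) (hg : ContDiff ℝ ∞ g) (c : ℝ) :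
    pd w (fun p => f p + c * g p) = fun p => pd w f p + c * pd w g p := by
  have hf' := hf.differentiable (by simp)
  have hg' := hg.differentiable (by simp)
  simp (disch := fun_prop) only [pd_add, pd_mul, pd_const]
  simp

/-- Prolongation is linear in the field, so the linearized equations are too. One combined form
serves for both sums and scalar multiples. -/
lemma IsPointSymmetry.add_smul {X Y : E → E} (hX : ContDiff ℝ ∞ X) (hY : ContDiff ℝ ∞ Y) (c : ℝ)
    (hsX : IsPointSymmetry X) (hsY : IsPointSymmetry Y) : IsPointSymmetry (X + c • Y) := by
  intro θ hθ
  have hZ : ContDiff ℝ ∞ (X + c • Y) := hX.add (contDiff_const.smul hY)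
  have cB : ∀ k, (fun p => ((X + c • Y) p).1 k) = fun p => (X p).1 k + c * (Y p).1 k := fun k => rfl
  have cF : ∀ k, (fun p => ((X + c • Y) p).2 k) = fun p => (X p).2 k + c * (Y p).2 k := fun k => rfl
  have vF : ∀ k p, ((X + c • Y) p).2 k = (X p).2 k + c * (Y p).2 k := fun k p => rfl
  have d0B : ∀ w k, pd w (fun p => (X p).1 k + c * (Y p).1 k)
      = fun p => pd w (fun p => (X p).1 k) p + c * pd w (fun p => (Y p).1 k) p := fun w k =>
    pd_add_smul w (contDiff_base hX k) (contDiff_base hY k) c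
  have d0F : ∀ w k, pd w (fun p => (X p).2 k + c * (Y p).2 k)
      = fun p => pd w (fun p => (X p).2 k) p + c * pd w (fun p => (Y p).2 k) p := fun w k =>
    pd_add_smul w (contDiff_fibre hX k) (contDiff_fibre hY k) c
  have d1B : ∀ z w k, pd z (fun p => pd w (fun p => (X p).1 k) p + c * pd w (fun p => (Y p).1 k) p)
      = fun p => pd z (pd w (fun p => (X p).1 k)) p + c * pd z (pd w (fun p => (Y p).1 k)) p :=
    fun z w k => pd_add_smul z ((contDiff_base hX k).pd w) ((contDiff_base hY k).pd w) c
  have d1F : ∀ z w k, pd z (fun p => pd w (fun p => (X p).2 k) p + c * pd w (fun p => (Y p).2 k) p)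
      = fun p => pd z (pd w (fun p => (X p).2 k)) p + c * pd z (pd w (fun p => (Y p).2 k)) p :=
    fun z w k => pd_add_smul z ((contDiff_fibre hX k).pd w) ((contDiff_fibre hY k).pd w) c
  have p2 : ∀ {i j : Fin 3}, i ≤ j → ∀ a, (prolong2 (X + c • Y) θ).2 a s(i, j) =
      (prolong2 X θ).2 a s(i, j) + c * (prolong2 Y θ).2 a s(i, j) := fun hij a => by
    simp only [prolong2_eq hZ θ a hij, prolong2_eq hX θ a hij, prolong2_eq hY θ a hij,
      totalDeriv1_totalDeriv0 (contDiff_base hX _), totalDeriv1_totalDeriv0 (contDiff_fibre hX _),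
      totalDeriv1_totalDeriv0 (contDiff_base hY _), totalDeriv1_totalDeriv0 (contDiff_fibre hY _),
      totalDeriv1_totalDeriv0 (contDiff_base hZ _), totalDeriv1_totalDeriv0 (contDiff_fibre hZ _),
      totalDeriv0_eq]
    simp only [cB, cF, d0B, d0F, d1B, d1F]
    ring
  have p1 : ∀ a i, (prolong1 (X + c • Y) θ.1).2 a i =
      (prolong1 X θ.1).2 a i + c * (prolong1 Y θ.1).2 a i := fun a i => by
    simp only [prolong1_eq, totalDeriv0_eq, cB, cF, d0B, d0F]
    ring
  have q01 := p2 (show (0 : Fin 3) ≤ 1 by decide)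
  have q12 := p2 (show (1 : Fin 3) ≤ 2 by decide)
  have q11 := p2 (le_refl (1 : Fin 3))
  have q22 := p2 (le_refl (2 : Fin 3))
  have eX := hsX θ hθ
  have eY := hsY θ hθ
  simp only [linearized_F1, linearized_F2] at eX eY ⊢
  simp only [q01, q12, q11, q22, p1, vF]
  constructor
  · linear_combination eX.1 + c * eY.1
  · linear_combination eX.2 + c * eY.2

/-- The space of point symmetries. -/
def symmetries : Submodule ℝ VF where
  carrier := {X | IsPointSymmetry X.1}
  add_mem' {X Y} hX hY := by
    have := IsPointSymmetry.add_smul X.contDiff Y.contDiff 1 hX hY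
    rwa [one_smul] at this
  zero_mem' := by
    intro θ _
    have h1 : ∀ a i, (prolong1 (0 : E → E) θ.1).2 a i = 0 := fun a i => by
      simp [prolong1_eq, totalDeriv0_eq, pd]
    have h2 : prolong2 (0 : E → E) θ = 0 := by
      have : prolong1 (0 : E → E) = 0 := by
        funext η
        refine Prod.ext rfl (funext fun a => funext fun i => ?_)
        simp [prolong1_eq, totalDeriv0_eq, pd]
      refine Prod.ext (by simp [prolong2, this]) (funext fun a => funext fun q => ?_)
      simp [prolong2, this, totalDeriv1, totalDeriv0]
    change fderiv ℝ F1 θ (prolong2 (0 : E → E) θ) = 0 ∧ fderiv ℝ F2 θ (prolong2 (0 : E → E) θ) = 0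
    simp [h2]
  smul_mem' c X hX := by
    -- The multiple c • X is obtained as X + (c - 1) • X from the combined linearity lemma.
    have h : IsPointSymmetry (X.1 + (c - 1) • X.1) :=
      IsPointSymmetry.add_smul X.contDiff X.contDiff (c - 1) hX hX
    have e : X.1 + (c - 1) • X.1 = c • X.1 := by module
    rwa [e] at h

/-! ### The five families are symmetries -/

lemma X1_fst_t (f : Fun) : (fun p => ((X1 f).1 p).1 0) = fun _ => 0 := rfl
lemma X1_fst_x (f : Fun) : (fun p => ((X1 f).1 p).1 1) = pull f := rfl
lemma X1_fst_y (f : Fun) : (fun p => ((X1 f).1 p).1 2) = fun _ => 0 := rfl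
lemma X1_snd_u (f : Fun) : (fun p => ((X1 f).1 p).2 0) = fun _ => 0 := rfl
lemma X1_snd_v (f : Fun) : (fun p => ((X1 f).1 p).2 1) = pull (dot f) := rfl

lemma X2_fst_t (f : Fun) : (fun p => ((X2 f).1 p).1 0) = fun _ => 0 := rfl
lemma X2_fst_x (f : Fun) : (fun p => ((X2 f).1 p).1 1) = fun _ => 0 := rfl
lemma X2_fst_y (f : Fun) : (fun p => ((X2 f).1 p).1 2) = pull f := rfl
lemma X2_snd_u (f : Fun) : (fun p => ((X2 f).1 p).2 0) = pull (dot f) := rfl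
lemma X2_snd_v (f : Fun) : (fun p => ((X2 f).1 p).2 1) = fun _ => 0 := rfl

lemma X3_fst_t (f : Fun) : (fun p => ((X3 f).1 p).1 0) = fun _ => 0 := rfl
lemma X3_fst_x (f : Fun) : (fun p => ((X3 f).1 p).1 1) = fun p => p.1 2 * pull f p := rfl
lemma X3_fst_y (f : Fun) : (fun p => ((X3 f).1 p).1 2) = fun _ => 0 := rfl
lemma X3_snd_u (f : Fun) : (fun p => ((X3 f).1 p).2 0) = fun p => -2 * pull f p := rfl
lemma X3_snd_v (f : Fun) : (fun p => ((X3 f).1 p).2 1) =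
    fun p => p.2 0 * pull f p + p.1 2 * pull (dot f) p := rfl

lemma X4_fst_t (f : Fun) : (fun p => ((X4 f).1 p).1 0) = pull f := rfl
lemma X4_fst_x (f : Fun) : (fun p => ((X4 f).1 p).1 1) = fun _ => 0 := rfl
lemma X4_fst_y (f : Fun) : (fun p => ((X4 f).1 p).1 2) =
    fun p => 1 / 2 * pull (dot f) p * p.1 2 := rfl
lemma X4_snd_u (f : Fun) : (fun p => ((X4 f).1 p).2 0) =
    fun p => 1 / 2 * (p.1 2 * pull (dot (dot f)) p - p.2 0 * pull (dot f) p) := rfl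
lemma X4_snd_v (f : Fun) : (fun p => ((X4 f).1 p).2 1) = fun p => -(pull (dot f) p * p.2 1) := rfl

lemma X5_fst_t (f : Fun) : (fun p => ((X5 f).1 p).1 0) = fun _ => 0 := rfl
-- The square y² is written as y·y so that `pd_mul` can differentiate it.
lemma X5_fst_x (f : Fun) : (fun p => ((X5 f).1 p).1 1) =
    fun p => p.1 2 * p.1 2 * pull (dot f) p + 2 * p.1 1 * pull f p := by
  funext p
  change p.1 2 ^ 2 * pull (dot f) p + 2 * p.1 1 * pull f p = _
  ring
lemma X5_fst_y (f : Fun) : (fun p => ((X5 f).1 p).1 2) = fun p => p.1 2 * pull f p := rfl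
lemma X5_snd_u (f : Fun) : (fun p => ((X5 f).1 p).2 0) =
    fun p => p.2 0 * pull f p - 3 * p.1 2 * pull (dot f) p := rfl
lemma X5_snd_v (f : Fun) : (fun p => ((X5 f).1 p).2 1) =
    fun p => p.1 2 * p.1 2 * pull (dot (dot f)) p + 2 * p.1 2 * p.2 0 * pull (dot f) p
      + 2 * p.2 1 * pull f p + 2 * p.1 1 * pull (dot f) p := by
  funext p
  change p.1 2 ^ 2 * pull (dot (dot f)) p + 2 * p.1 2 * p.2 0 * pull (dot f) p
    + 2 * p.2 1 * pull f p + 2 * p.1 1 * pull (dot f) p = _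
  ring

lemma X1_mem (f : Fun) : X1 f ∈ symmetries := by
  intro θ _
  simp only [linearized_F1, linearized_F2,
    prolong2_eq (X1 f).contDiff _ _ (show (0 : Fin 3) ≤ 1 by decide),
    prolong2_eq (X1 f).contDiff _ _ (show (1 : Fin 3) ≤ 2 by decide),
    prolong2_eq (X1 f).contDiff _ _ (le_refl (1 : Fin 3)),
    prolong2_eq (X1 f).contDiff _ _ (le_refl (2 : Fin 3)), prolong1_eq,
    totalDeriv1_totalDeriv0 (contDiff_base (X1 f).contDiff _),
    totalDeriv1_totalDeriv0 (contDiff_fibre (X1 f).contDiff _), totalDeriv0_eq]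
  simp only [congrFun (X1_snd_u f) _, congrFun (X1_snd_v f) _]
  simp (disch := fun_prop) only [X1_fst_t, X1_fst_x, X1_fst_y, X1_snd_u, X1_snd_v,
    pd_const, pd_mul, pd_pull]
  simp [eB, eF]
  constructor <;> ring

lemma X2_mem (f : Fun) : X2 f ∈ symmetries := by
  intro θ _
  simp only [linearized_F1, linearized_F2,
    prolong2_eq (X2 f).contDiff _ _ (show (0 : Fin 3) ≤ 1 by decide),
    prolong2_eq (X2 f).contDiff _ _ (show (1 : Fin 3) ≤ 2 by decide),
    prolong2_eq (X2 f).contDiff _ _ (le_refl (1 : Fin 3)),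
    prolong2_eq (X2 f).contDiff _ _ (le_refl (2 : Fin 3)), prolong1_eq,
    totalDeriv1_totalDeriv0 (contDiff_base (X2 f).contDiff _),
    totalDeriv1_totalDeriv0 (contDiff_fibre (X2 f).contDiff _), totalDeriv0_eq]
  simp only [congrFun (X2_snd_u f) _, congrFun (X2_snd_v f) _]
  simp (disch := fun_prop) only [X2_fst_t, X2_fst_x, X2_fst_y, X2_snd_u, X2_snd_v,
    pd_const, pd_mul, pd_pull]
  simp [eB, eF, Sym2.eq_swap (a := (2 : Fin 3)) (b := 1)]
  constructor <;> ring

lemma X3_mem (f : Fun) : X3 f ∈ symmetries := by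
  intro θ hθ
  have h1 := hθ.1
  rw [F1_eq] at h1
  simp only [linearized_F1, linearized_F2,
    prolong2_eq (X3 f).contDiff _ _ (show (0 : Fin 3) ≤ 1 by decide),
    prolong2_eq (X3 f).contDiff _ _ (show (1 : Fin 3) ≤ 2 by decide),
    prolong2_eq (X3 f).contDiff _ _ (le_refl (1 : Fin 3)),
    prolong2_eq (X3 f).contDiff _ _ (le_refl (2 : Fin 3)), prolong1_eq,
    totalDeriv1_totalDeriv0 (contDiff_base (X3 f).contDiff _),
    totalDeriv1_totalDeriv0 (contDiff_fibre (X3 f).contDiff _), totalDeriv0_eq]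
  simp only [congrFun (X3_snd_u f) _, congrFun (X3_snd_v f) _]
  simp (disch := fun_prop) only [X3_fst_t, X3_fst_x, X3_fst_y, X3_snd_u, X3_snd_v,
    pd_const, pd_mul, pd_add, pd_sub, pd_neg, pd_pull, pd_base, pd_fibre]
  simp [eB, eF, Sym2.eq_swap (a := (2 : Fin 3)) (b := 1), Sym2.eq_swap (a := (1 : Fin 3)) (b := 0),
    Sym2.eq_swap (a := (2 : Fin 3)) (b := 0)]
  constructor
  · ring
  -- Here L F₁ vanishes identically, while L F₂ = c F₁.
  · linear_combination pull f θ.1.1 * h1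

set_option maxHeartbeats 2000000 in
lemma X4_mem (f : Fun) : X4 f ∈ symmetries := by
  intro θ hθ
  have h1 := hθ.1
  have h2 := hθ.2
  rw [F1_eq] at h1
  rw [F2_eq] at h2
  simp only [linearized_F1, linearized_F2,
    prolong2_eq (X4 f).contDiff _ _ (show (0 : Fin 3) ≤ 1 by decide),
    prolong2_eq (X4 f).contDiff _ _ (show (1 : Fin 3) ≤ 2 by decide),
    prolong2_eq (X4 f).contDiff _ _ (le_refl (1 : Fin 3)),
    prolong2_eq (X4 f).contDiff _ _ (le_refl (2 : Fin 3)), prolong1_eq,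
    totalDeriv1_totalDeriv0 (contDiff_base (X4 f).contDiff _),
    totalDeriv1_totalDeriv0 (contDiff_fibre (X4 f).contDiff _), totalDeriv0_eq]
  -- Each reflexive identity is a template: only its right-hand side is evaluated. The result is a
  -- table of the first and second derivatives of each component, computed once for arbitrary
  -- directions.
  have ht : ∀ w, pd w (fun p => ((X4 f).1 p).1 0) = pd w (fun p => ((X4 f).1 p).1 0) :=
    fun _ => rfl
  have htt := fun z w => congrArg (pd z) (ht w)
  conv at ht =>
    intro w; rhs
    simp (disch := fun_prop) only [X4_fst_t, pd_const, pd_mul, pd_add, pd_sub, pd_neg, pd_pull,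
      pd_base, pd_fibre]
  conv at htt =>
    intro z w; rhs
    simp (disch := fun_prop) only [ht, pd_const, pd_mul, pd_add, pd_sub, pd_neg, pd_pull,
      pd_base, pd_fibre]
  have hx : ∀ w, pd w (fun p => ((X4 f).1 p).1 1) = pd w (fun p => ((X4 f).1 p).1 1) :=
    fun _ => rfl
  have hxx := fun z w => congrArg (pd z) (hx w)
  conv at hx =>
    intro w; rhs
    simp (disch := fun_prop) only [X4_fst_x, pd_const, pd_mul, pd_add, pd_sub, pd_neg, pd_pull,
      pd_base, pd_fibre]
  conv at hxx =>
    intro z w; rhs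
    simp (disch := fun_prop) only [hx, pd_const, pd_mul, pd_add, pd_sub, pd_neg, pd_pull,
      pd_base, pd_fibre]
  have hy : ∀ w, pd w (fun p => ((X4 f).1 p).1 2) = pd w (fun p => ((X4 f).1 p).1 2) :=
    fun _ => rfl
  have hyy := fun z w => congrArg (pd z) (hy w)
  conv at hy =>
    intro w; rhs
    simp (disch := fun_prop) only [X4_fst_y, pd_const, pd_mul, pd_add, pd_sub, pd_neg, pd_pull,
      pd_base, pd_fibre]
  conv at hyy =>
    intro z w; rhs
    simp (disch := fun_prop) only [hy, pd_const, pd_mul, pd_add, pd_sub, pd_neg, pd_pull,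
      pd_base, pd_fibre]
  have hu : ∀ w, pd w (fun p => ((X4 f).1 p).2 0) = pd w (fun p => ((X4 f).1 p).2 0) :=
    fun _ => rfl
  have huu := fun z w => congrArg (pd z) (hu w)
  conv at hu =>
    intro w; rhs
    simp (disch := fun_prop) only [X4_snd_u, pd_const, pd_mul, pd_add, pd_sub, pd_neg, pd_pull,
      pd_base, pd_fibre]
  conv at huu =>
    intro z w; rhs
    simp (disch := fun_prop) only [hu, pd_const, pd_mul, pd_add, pd_sub, pd_neg, pd_pull,
      pd_base, pd_fibre]
  have hv : ∀ w, pd w (fun p => ((X4 f).1 p).2 1) = pd w (fun p => ((X4 f).1 p).2 1) :=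
    fun _ => rfl
  have hvv := fun z w => congrArg (pd z) (hv w)
  conv at hv =>
    intro w; rhs
    simp (disch := fun_prop) only [X4_snd_v, pd_const, pd_mul, pd_add, pd_sub, pd_neg, pd_pull,
      pd_base, pd_fibre]
  conv at hvv =>
    intro z w; rhs
    simp (disch := fun_prop) only [hv, pd_const, pd_mul, pd_add, pd_sub, pd_neg, pd_pull,
      pd_base, pd_fibre]
  -- Second derivatives are replaced first, since evaluating the inner first derivatives would
  -- destroy the patterns on the left of these tables.
  simp only [htt, hxx, hyy, huu, hvv]
  simp only [ht, hx, hy, hu, hv]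
  simp only [congrFun (X4_snd_u f) _, congrFun (X4_snd_v f) _]
  simp [eB, eF, Sym2.eq_swap (a := (2 : Fin 3)) (b := 1), Sym2.eq_swap (a := (1 : Fin 3)) (b := 0),
    Sym2.eq_swap (a := (2 : Fin 3)) (b := 0)]
  constructor
  -- The factors -3/2 and -2 are the weights of u_tx and v_tx under the scaling d = t, where t, x,
  -- y, u, v have weights 1, 0, 1/2, -1/2, -1.
  · linear_combination (-3 / 2) * pull (dot f) θ.1.1 * h1
  · linear_combination (-2) * pull (dot f) θ.1.1 * h2

set_option maxHeartbeats 2000000 in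
lemma X5_mem (f : Fun) : X5 f ∈ symmetries := by
  intro θ hθ
  have h1 := hθ.1
  have h2 := hθ.2
  rw [F1_eq] at h1
  rw [F2_eq] at h2
  simp only [linearized_F1, linearized_F2,
    prolong2_eq (X5 f).contDiff _ _ (show (0 : Fin 3) ≤ 1 by decide),
    prolong2_eq (X5 f).contDiff _ _ (show (1 : Fin 3) ≤ 2 by decide),
    prolong2_eq (X5 f).contDiff _ _ (le_refl (1 : Fin 3)),
    prolong2_eq (X5 f).contDiff _ _ (le_refl (2 : Fin 3)), prolong1_eq,
    totalDeriv1_totalDeriv0 (contDiff_base (X5 f).contDiff _),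
    totalDeriv1_totalDeriv0 (contDiff_fibre (X5 f).contDiff _), totalDeriv0_eq]
  have ht : ∀ w, pd w (fun p => ((X5 f).1 p).1 0) = pd w (fun p => ((X5 f).1 p).1 0) :=
    fun _ => rfl
  have htt := fun z w => congrArg (pd z) (ht w)
  conv at ht =>
    intro w; rhs
    simp (disch := fun_prop) only [X5_fst_t, pd_const, pd_mul, pd_add, pd_sub, pd_neg, pd_pull,
      pd_base, pd_fibre]
  conv at htt =>
    intro z w; rhs
    simp (disch := fun_prop) only [ht, pd_const, pd_mul, pd_add, pd_sub, pd_neg, pd_pull,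
      pd_base, pd_fibre]
  have hx : ∀ w, pd w (fun p => ((X5 f).1 p).1 1) = pd w (fun p => ((X5 f).1 p).1 1) :=
    fun _ => rfl
  have hxx := fun z w => congrArg (pd z) (hx w)
  conv at hx =>
    intro w; rhs
    simp (disch := fun_prop) only [X5_fst_x, pd_const, pd_mul, pd_add, pd_sub, pd_neg, pd_pull,
      pd_base, pd_fibre]
  conv at hxx =>
    intro z w; rhs
    simp (disch := fun_prop) only [hx, pd_const, pd_mul, pd_add, pd_sub, pd_neg, pd_pull,
      pd_base, pd_fibre]
  have hy : ∀ w, pd w (fun p => ((X5 f).1 p).1 2) = pd w (fun p => ((X5 f).1 p).1 2) :=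
    fun _ => rfl
  have hyy := fun z w => congrArg (pd z) (hy w)
  conv at hy =>
    intro w; rhs
    simp (disch := fun_prop) only [X5_fst_y, pd_const, pd_mul, pd_add, pd_sub, pd_neg, pd_pull,
      pd_base, pd_fibre]
  conv at hyy =>
    intro z w; rhs
    simp (disch := fun_prop) only [hy, pd_const, pd_mul, pd_add, pd_sub, pd_neg, pd_pull,
      pd_base, pd_fibre]
  have hu : ∀ w, pd w (fun p => ((X5 f).1 p).2 0) = pd w (fun p => ((X5 f).1 p).2 0) :=
    fun _ => rfl
  have huu := fun z w => congrArg (pd z) (hu w)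
  conv at hu =>
    intro w; rhs
    simp (disch := fun_prop) only [X5_snd_u, pd_const, pd_mul, pd_add, pd_sub, pd_neg, pd_pull,
      pd_base, pd_fibre]
  conv at huu =>
    intro z w; rhs
    simp (disch := fun_prop) only [hu, pd_const, pd_mul, pd_add, pd_sub, pd_neg, pd_pull,
      pd_base, pd_fibre]
  have hv : ∀ w, pd w (fun p => ((X5 f).1 p).2 1) = pd w (fun p => ((X5 f).1 p).2 1) :=
    fun _ => rfl
  have hvv := fun z w => congrArg (pd z) (hv w)
  conv at hv =>
    intro w; rhs
    simp (disch := fun_prop) only [X5_snd_v, pd_const, pd_mul, pd_add, pd_sub, pd_neg, pd_pull,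
      pd_base, pd_fibre]
  conv at hvv =>
    intro z w; rhs
    simp (disch := fun_prop) only [hv, pd_const, pd_mul, pd_add, pd_sub, pd_neg, pd_pull,
      pd_base, pd_fibre]
  simp only [htt, hxx, hyy, huu, hvv]
  simp only [ht, hx, hy, hu, hv]
  simp only [congrFun (X5_snd_u f) _, congrFun (X5_snd_v f) _]
  simp [eB, eF, Sym2.eq_swap (a := (2 : Fin 3)) (b := 1), Sym2.eq_swap (a := (1 : Fin 3)) (b := 0),
    Sym2.eq_swap (a := (2 : Fin 3)) (b := 0)]
  constructor
  -- For e = 1 the field is a scaling with weights 0, 2, 1, 1, 2 of t, x, y, u, v, under which F₁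
  -- has weight -1 and F₂ weight 0. The F₁ term in L F₂ comes from the summand 2yuė of the
  -- ∂_v-component.
  · linear_combination - pull f θ.1.1 * h1
  · linear_combination 2 * θ.1.1.1 2 * pull (dot f) θ.1.1 * h1

/-! ### Every symmetry lies in the span -/

/-- Successive subtraction removes T, then Y, then X. The order matters: `IsPointSymmetry.Xyy` needs
T and Y to be gone already, and subtracting `X3` and `X1` does not bring them back. -/
lemma exists_eq_of_mem_symmetries {X : VF} (hX : X ∈ symmetries) :
    ∃ a b c d e : Fun, X = X1 a + X2 b + X3 c + X4 d + X5 e := by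
  obtain ⟨d, hd⟩ : ∃ d : Fun, (fun p => (X.1 p).1 0) = pull d :=
    have h := hX.isReduced X.contDiff
    exists_pull (contDiff_base X.contDiff 0) h.Tx h.Ty h.Tu h.Tv
  set Y : VF := X - X4 d with hYdef
  have hY : Y ∈ symmetries := sub_mem hX (X4_mem d)
  have hYT : (fun p => (Y.1 p).1 0) = 0 := by
    funext p
    exact sub_eq_zero.2 (congrFun hd p)
  obtain ⟨e, b, heb⟩ : ∃ e b : Fun, (fun p => (Y.1 p).1 2) = fun p => p.1 2 * pull e p + pull b p :=
    have h := IsPointSymmetry.isReduced Y.contDiff hY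
    exists_pull_affine (contDiff_base Y.contDiff 2) h.Yx (IsPointSymmetry.Yyy Y.contDiff hY)
      h.Yu h.Yv
  set Z : VF := Y - X5 e - X2 b with hZdef
  have hZ : Z ∈ symmetries := sub_mem (sub_mem hY (X5_mem e)) (X2_mem b)
  have hZT : (fun p => (Z.1 p).1 0) = 0 := by
    funext p
    have h0 : (Y.1 p).1 0 = 0 := congrFun hYT p
    change (Y.1 p).1 0 - 0 - 0 = 0
    simp [h0]
  have hZY : (fun p => (Z.1 p).1 2) = 0 := by
    funext p
    have h0 := congrFun heb p
    change (Y.1 p).1 2 - p.1 2 * pull e p - pull b p = 0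
    linarith
  obtain ⟨c, a, hca⟩ : ∃ c a : Fun, (fun p => (Z.1 p).1 1) = fun p => p.1 2 * pull c p + pull a p := by
    have h := IsPointSymmetry.isReduced Z.contDiff hZ
    refine exists_pull_affine (contDiff_base Z.contDiff 1) (funext fun p => ?_)
      (IsPointSymmetry.Xyy Z.contDiff hZ hZT hZY) h.Xu h.Xv
    rw [h.Xx, hZT, hZY]; simp [pd_zero]
  set W : VF := Z - X3 c - X1 a with hWdef
  have hW : W ∈ symmetries := sub_mem (sub_mem hZ (X3_mem c)) (X1_mem a)
  have hWT : (fun p => (W.1 p).1 0) = 0 := by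
    funext p
    have h0 : (Z.1 p).1 0 = 0 := congrFun hZT p
    change (Z.1 p).1 0 - 0 - 0 = 0
    simp [h0]
  have hWX : (fun p => (W.1 p).1 1) = 0 := by
    funext p
    have h0 := congrFun hca p
    change (Z.1 p).1 1 - p.1 2 * pull c p - pull a p = 0
    linarith
  have hWY : (fun p => (W.1 p).1 2) = 0 := by
    funext p
    have h0 : (Z.1 p).1 2 = 0 := congrFun hZY p
    change (Z.1 p).1 2 - 0 - 0 = 0
    simp [h0]
  -- The reduced form expresses U and V through derivatives of the base components, all of which now
  -- vanish.
  have hW0 : W = 0 := by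
    have h := IsPointSymmetry.isReduced W.contDiff hW
    apply Subtype.ext
    funext p
    refine Prod.ext (funext fun i => ?_) (funext fun i => ?_)
    · fin_cases i
      exacts [congrFun hWT p, congrFun hWX p, congrFun hWY p]
    · fin_cases i
      · refine (h.U p).trans ?_
        rw [hWX, hWY]; simp [pd_zero]
      · refine (h.V p).trans ?_
        rw [hWX, hWY]; simp [pd_zero]
  refine ⟨a, b, c, d, e, ?_⟩
  have : X = W + X1 a + X3 c + X2 b + X5 e + X4 d := by
    rw [hWdef, hZdef, hYdef]; abel
  rw [this, hW0]; abel

/-! ### Derivatives and antiderivatives in t; the commutator table -/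

lemma pull_add (f g : Fun) (p : E) : pull (f + g) p = pull f p + pull g p := rfl
lemma pull_sub (f g : Fun) (p : E) : pull (f - g) p = pull f p - pull g p := rfl
lemma pull_neg (f : Fun) (p : E) : pull (-f) p = -pull f p := rfl
lemma pull_mul (f g : Fun) (p : E) : pull (f * g) p = pull f p * pull g p := rfl
lemma pull_smul (c : ℝ) (f : Fun) (p : E) : pull (c • f) p = c * pull f p := rfl
lemma pull_two (p : E) : pull 2 p = 2 := rfl
lemma pull_zero (p : E) : pull 0 p = 0 := rfl

lemma dot_mul (f g : Fun) : dot (f * g) = dot f * g + f * dot g := by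
  apply Subtype.ext; funext t
  exact deriv_mul (f.differentiableAt t) (g.differentiableAt t)

lemma dot_one : dot 1 = 0 := by
  apply Subtype.ext; funext t
  exact deriv_const t (1 : ℝ)

lemma dot_two : dot 2 = 0 := by
  apply Subtype.ext; funext t
  exact deriv_const t (2 : ℝ)

/-- Every smooth function of `t` has a smooth antiderivative. -/
lemma dot_surjective : Function.Surjective dot := by
  intro f
  have hc : Continuous f.1 := f.contDiff.continuous
  have hd : ∀ t, HasDerivAt (fun t => ∫ s in (0 : ℝ)..t, f.1 s) (f.1 t) t := fun t =>
    (hc.integral_hasStrictDerivAt 0 t).hasDerivAt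
  have hderiv : deriv (fun t => ∫ s in (0 : ℝ)..t, f.1 s) = f.1 := funext fun t => (hd t).deriv
  refine ⟨⟨fun t => ∫ s in (0 : ℝ)..t, f.1 s, contDiff_infty_iff_deriv.2
    ⟨fun t => (hd t).differentiableAt, ?_⟩⟩, Subtype.ext hderiv⟩
  rw [hderiv]
  exact f.contDiff

lemma bracket_fst (X Y : VF) (p : E) (k : Fin 3) : ((⁅X, Y⁆ : VF).1 p).1 k =
    pd (X.1 p) (fun p => (Y.1 p).1 k) p - pd (Y.1 p) (fun p => (X.1 p).1 k) p := by
  have key : ∀ (Z : VF) (w : E), (fderiv ℝ Z.1 p w).1 k = pd w (fun p => (Z.1 p).1 k) p := by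
    intro Z w
    have h := ((ContinuousLinearMap.proj (R := ℝ) (φ := fun _ : Fin 3 => ℝ) k).comp
      (ContinuousLinearMap.fst ℝ (Fin 3 → ℝ) (Fin 2 → ℝ))).hasFDerivAt.comp p
        (Z.differentiableAt p).hasFDerivAt
    exact (congrArg (fun L => L w) h.fderiv).symm
  rw [VF.coe_bracket, VectorField.lieBracket, ← key, ← key]
  rfl

lemma bracket_snd (X Y : VF) (p : E) (k : Fin 2) : ((⁅X, Y⁆ : VF).1 p).2 k =
    pd (X.1 p) (fun p => (Y.1 p).2 k) p - pd (Y.1 p) (fun p => (X.1 p).2 k) p := by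
  have key : ∀ (Z : VF) (w : E), (fderiv ℝ Z.1 p w).2 k = pd w (fun p => (Z.1 p).2 k) p := by
    intro Z w
    have h := ((ContinuousLinearMap.proj (R := ℝ) (φ := fun _ : Fin 2 => ℝ) k).comp
      (ContinuousLinearMap.snd ℝ (Fin 3 → ℝ) (Fin 2 → ℝ))).hasFDerivAt.comp p
        (Z.differentiableAt p).hasFDerivAt
    exact (congrArg (fun L => L w) h.fderiv).symm
  rw [VF.coe_bracket, VectorField.lieBracket, ← key, ← key]
  rfl

lemma VF.ext_components {X Y : VF} (h : ∀ p, ((X.1 p).1 0 = (Y.1 p).1 0 ∧ (X.1 p).1 1 = (Y.1 p).1 1 ∧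
    (X.1 p).1 2 = (Y.1 p).1 2) ∧ (X.1 p).2 0 = (Y.1 p).2 0 ∧ (X.1 p).2 1 = (Y.1 p).2 1) :
    X = Y := by
  apply Subtype.ext
  funext p
  obtain ⟨⟨h1, h2, h3⟩, h4, h5⟩ := h p
  refine Prod.ext (funext fun i => ?_) (funext fun i => ?_)
  · fin_cases i
    exacts [h1, h2, h3]
  · fin_cases i
    exacts [h4, h5]

lemma VF.zero_fst (p : E) (k : Fin 3) : ((0 : VF).1 p).1 k = 0 := rfl
lemma VF.zero_snd (p : E) (k : Fin 2) : ((0 : VF).1 p).2 k = 0 := rfl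
lemma VF.add_fst (X Y : VF) (p : E) (k : Fin 3) :
    ((X + Y).1 p).1 k = (X.1 p).1 k + (Y.1 p).1 k := rfl
lemma VF.add_snd (X Y : VF) (p : E) (k : Fin 2) :
    ((X + Y).1 p).2 k = (X.1 p).2 k + (Y.1 p).2 k := rfl

lemma bracket_X1_X1 (f g : Fun) : ⁅X1 f, X1 g⁆ = 0 := by
  refine VF.ext_components fun p => ?_
  simp (disch := fun_prop) only [bracket_fst, bracket_snd,
    X1_fst_t, X1_fst_x, X1_fst_y, X1_snd_u, X1_snd_v, pd_const, pd_mul, pd_add, pd_sub, pd_neg,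
    pd_pull, pd_base, pd_fibre]
  simp only [VF.add_fst, VF.add_snd, VF.zero_fst, VF.zero_snd,
    congrFun (X1_fst_t _) _, congrFun (X1_fst_x _) _, congrFun (X1_fst_y _) _,
    congrFun (X1_snd_u _) _, congrFun (X1_snd_v _) _, map_add dot, map_sub dot, map_neg dot, map_smul dot,
    dot_mul, dot_two, pull_add, pull_sub, pull_neg, pull_mul, pull_smul, pull_two, pull_zero]
  refine ⟨⟨?_, ?_, ?_⟩, ?_, ?_⟩ <;> ring

lemma bracket_X1_X2 (f g : Fun) : ⁅X1 f, X2 g⁆ = 0 := by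
  refine VF.ext_components fun p => ?_
  simp (disch := fun_prop) only [bracket_fst, bracket_snd,
    X1_fst_t, X1_fst_x, X1_fst_y, X1_snd_u, X1_snd_v, X2_fst_t, X2_fst_x, X2_fst_y, X2_snd_u,
    X2_snd_v, pd_const, pd_mul, pd_add, pd_sub, pd_neg, pd_pull, pd_base, pd_fibre]
  simp only [VF.add_fst, VF.add_snd, VF.zero_fst, VF.zero_snd,
    congrFun (X1_fst_t _) _, congrFun (X1_fst_x _) _, congrFun (X1_fst_y _) _,
    congrFun (X1_snd_u _) _, congrFun (X1_snd_v _) _, congrFun (X2_fst_t _) _,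
    congrFun (X2_fst_x _) _, congrFun (X2_fst_y _) _, congrFun (X2_snd_u _) _,
    congrFun (X2_snd_v _) _, map_add dot, map_sub dot, map_neg dot, map_smul dot, dot_mul, dot_two, pull_add,
    pull_sub, pull_neg, pull_mul, pull_smul, pull_two, pull_zero]
  refine ⟨⟨?_, ?_, ?_⟩, ?_, ?_⟩ <;> ring

lemma bracket_X1_X3 (f g : Fun) : ⁅X1 f, X3 g⁆ = 0 := by
  refine VF.ext_components fun p => ?_
  simp (disch := fun_prop) only [bracket_fst, bracket_snd,
    X1_fst_t, X1_fst_x, X1_fst_y, X1_snd_u, X1_snd_v, X3_fst_t, X3_fst_x, X3_fst_y, X3_snd_u,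
    X3_snd_v, pd_const, pd_mul, pd_add, pd_sub, pd_neg, pd_pull, pd_base, pd_fibre]
  simp only [VF.add_fst, VF.add_snd, VF.zero_fst, VF.zero_snd,
    congrFun (X1_fst_t _) _, congrFun (X1_fst_x _) _, congrFun (X1_fst_y _) _,
    congrFun (X1_snd_u _) _, congrFun (X1_snd_v _) _, congrFun (X3_fst_t _) _,
    congrFun (X3_fst_x _) _, congrFun (X3_fst_y _) _, congrFun (X3_snd_u _) _,
    congrFun (X3_snd_v _) _, map_add dot, map_sub dot, map_neg dot, map_smul dot, dot_mul, dot_two, pull_add,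
    pull_sub, pull_neg, pull_mul, pull_smul, pull_two, pull_zero]
  refine ⟨⟨?_, ?_, ?_⟩, ?_, ?_⟩ <;> ring

lemma bracket_X1_X4 (f g : Fun) : ⁅X1 f, X4 g⁆ = X1 (-(g * dot f)) := by
  refine VF.ext_components fun p => ?_
  simp (disch := fun_prop) only [bracket_fst, bracket_snd,
    X1_fst_t, X1_fst_x, X1_fst_y, X1_snd_u, X1_snd_v, X4_fst_t, X4_fst_x, X4_fst_y, X4_snd_u,
    X4_snd_v, pd_const, pd_mul, pd_add, pd_sub, pd_neg, pd_pull, pd_base, pd_fibre]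
  simp only [VF.add_fst, VF.add_snd, VF.zero_fst, VF.zero_snd,
    congrFun (X1_fst_t _) _, congrFun (X1_fst_x _) _, congrFun (X1_fst_y _) _,
    congrFun (X1_snd_u _) _, congrFun (X1_snd_v _) _, congrFun (X4_fst_t _) _,
    congrFun (X4_fst_x _) _, congrFun (X4_fst_y _) _, congrFun (X4_snd_u _) _,
    congrFun (X4_snd_v _) _, map_add dot, map_sub dot, map_neg dot, map_smul dot, dot_mul, dot_two, pull_add,
    pull_sub, pull_neg, pull_mul, pull_smul, pull_two, pull_zero]
  refine ⟨⟨?_, ?_, ?_⟩, ?_, ?_⟩ <;> ring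

lemma bracket_X1_X5 (f g : Fun) : ⁅X1 f, X5 g⁆ = X1 (2 * f * g) := by
  refine VF.ext_components fun p => ?_
  simp (disch := fun_prop) only [bracket_fst, bracket_snd,
    X1_fst_t, X1_fst_x, X1_fst_y, X1_snd_u, X1_snd_v, X5_fst_t, X5_fst_x, X5_fst_y, X5_snd_u,
    X5_snd_v, pd_const, pd_mul, pd_add, pd_sub, pd_neg, pd_pull, pd_base, pd_fibre]
  simp only [VF.add_fst, VF.add_snd, VF.zero_fst, VF.zero_snd,
    congrFun (X1_fst_t _) _, congrFun (X1_fst_x _) _, congrFun (X1_fst_y _) _,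
    congrFun (X1_snd_u _) _, congrFun (X1_snd_v _) _, congrFun (X5_fst_t _) _,
    congrFun (X5_fst_x _) _, congrFun (X5_fst_y _) _, congrFun (X5_snd_u _) _,
    congrFun (X5_snd_v _) _, map_add dot, map_sub dot, map_neg dot, map_smul dot, dot_mul, dot_two, pull_add,
    pull_sub, pull_neg, pull_mul, pull_smul, pull_two, pull_zero]
  refine ⟨⟨?_, ?_, ?_⟩, ?_, ?_⟩ <;> ring

lemma bracket_X2_X2 (f g : Fun) : ⁅X2 f, X2 g⁆ = 0 := by
  refine VF.ext_components fun p => ?_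
  simp (disch := fun_prop) only [bracket_fst, bracket_snd,
    X2_fst_t, X2_fst_x, X2_fst_y, X2_snd_u, X2_snd_v, pd_const, pd_mul, pd_add, pd_sub, pd_neg,
    pd_pull, pd_base, pd_fibre]
  simp only [VF.add_fst, VF.add_snd, VF.zero_fst, VF.zero_snd,
    congrFun (X2_fst_t _) _, congrFun (X2_fst_x _) _, congrFun (X2_fst_y _) _,
    congrFun (X2_snd_u _) _, congrFun (X2_snd_v _) _, map_add dot, map_sub dot, map_neg dot, map_smul dot,
    dot_mul, dot_two, pull_add, pull_sub, pull_neg, pull_mul, pull_smul, pull_two, pull_zero]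
  refine ⟨⟨?_, ?_, ?_⟩, ?_, ?_⟩ <;> ring

lemma bracket_X2_X3 (f g : Fun) : ⁅X2 f, X3 g⁆ = X1 (f * g) := by
  refine VF.ext_components fun p => ?_
  simp (disch := fun_prop) only [bracket_fst, bracket_snd,
    X1_fst_t, X1_fst_x, X1_fst_y, X1_snd_u, X1_snd_v, X2_fst_t, X2_fst_x, X2_fst_y, X2_snd_u,
    X2_snd_v, X3_fst_t, X3_fst_x, X3_fst_y, X3_snd_u, X3_snd_v, pd_const, pd_mul, pd_add,
    pd_sub, pd_neg, pd_pull, pd_base, pd_fibre]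
  simp only [VF.add_fst, VF.add_snd, VF.zero_fst, VF.zero_snd,
    congrFun (X1_fst_t _) _, congrFun (X1_fst_x _) _, congrFun (X1_fst_y _) _,
    congrFun (X1_snd_u _) _, congrFun (X1_snd_v _) _, congrFun (X2_fst_t _) _,
    congrFun (X2_fst_x _) _, congrFun (X2_fst_y _) _, congrFun (X2_snd_u _) _,
    congrFun (X2_snd_v _) _, congrFun (X3_fst_t _) _, congrFun (X3_fst_x _) _,
    congrFun (X3_fst_y _) _, congrFun (X3_snd_u _) _, congrFun (X3_snd_v _) _, map_add dot, map_sub dot,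
    map_neg dot, map_smul dot, dot_mul, dot_two, pull_add, pull_sub, pull_neg, pull_mul, pull_smul,
    pull_two, pull_zero]
  refine ⟨⟨?_, ?_, ?_⟩, ?_, ?_⟩ <;> ring

lemma bracket_X2_X4 (f g : Fun) : ⁅X2 f, X4 g⁆ = X2 ((1 / 2 : ℝ) • (f * dot g) - g * dot f) := by
  refine VF.ext_components fun p => ?_
  simp (disch := fun_prop) only [bracket_fst, bracket_snd,
    X2_fst_t, X2_fst_x, X2_fst_y, X2_snd_u, X2_snd_v, X4_fst_t, X4_fst_x, X4_fst_y, X4_snd_u,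
    X4_snd_v, pd_const, pd_mul, pd_add, pd_sub, pd_neg, pd_pull, pd_base, pd_fibre]
  simp only [VF.add_fst, VF.add_snd, VF.zero_fst, VF.zero_snd,
    congrFun (X2_fst_t _) _, congrFun (X2_fst_x _) _, congrFun (X2_fst_y _) _,
    congrFun (X2_snd_u _) _, congrFun (X2_snd_v _) _, congrFun (X4_fst_t _) _,
    congrFun (X4_fst_x _) _, congrFun (X4_fst_y _) _, congrFun (X4_snd_u _) _,
    congrFun (X4_snd_v _) _, map_add dot, map_sub dot, map_neg dot, map_smul dot, dot_mul, dot_two, pull_add,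
    pull_sub, pull_neg, pull_mul, pull_smul, pull_two, pull_zero]
  refine ⟨⟨?_, ?_, ?_⟩, ?_, ?_⟩ <;> ring

lemma bracket_X2_X5 (f g : Fun) : ⁅X2 f, X5 g⁆ = X2 (f * g) + X3 (2 * f * dot g) := by
  refine VF.ext_components fun p => ?_
  simp (disch := fun_prop) only [bracket_fst, bracket_snd,
    X2_fst_t, X2_fst_x, X2_fst_y, X2_snd_u, X2_snd_v, X3_fst_t, X3_fst_x, X3_fst_y, X3_snd_u,
    X3_snd_v, X5_fst_t, X5_fst_x, X5_fst_y, X5_snd_u, X5_snd_v, pd_const, pd_mul, pd_add,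
    pd_sub, pd_neg, pd_pull, pd_base, pd_fibre]
  simp only [VF.add_fst, VF.add_snd, VF.zero_fst, VF.zero_snd,
    congrFun (X2_fst_t _) _, congrFun (X2_fst_x _) _, congrFun (X2_fst_y _) _,
    congrFun (X2_snd_u _) _, congrFun (X2_snd_v _) _, congrFun (X3_fst_t _) _,
    congrFun (X3_fst_x _) _, congrFun (X3_fst_y _) _, congrFun (X3_snd_u _) _,
    congrFun (X3_snd_v _) _, congrFun (X5_fst_t _) _, congrFun (X5_fst_x _) _,
    congrFun (X5_fst_y _) _, congrFun (X5_snd_u _) _, congrFun (X5_snd_v _) _, map_add dot, map_sub dot,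
    map_neg dot, map_smul dot, dot_mul, dot_two, pull_add, pull_sub, pull_neg, pull_mul, pull_smul,
    pull_two, pull_zero]
  refine ⟨⟨?_, ?_, ?_⟩, ?_, ?_⟩ <;> ring

lemma bracket_X3_X3 (f g : Fun) : ⁅X3 f, X3 g⁆ = 0 := by
  refine VF.ext_components fun p => ?_
  simp (disch := fun_prop) only [bracket_fst, bracket_snd,
    X3_fst_t, X3_fst_x, X3_fst_y, X3_snd_u, X3_snd_v, pd_const, pd_mul, pd_add, pd_sub, pd_neg,
    pd_pull, pd_base, pd_fibre]
  simp only [VF.add_fst, VF.add_snd, VF.zero_fst, VF.zero_snd,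
    congrFun (X3_fst_t _) _, congrFun (X3_fst_x _) _, congrFun (X3_fst_y _) _,
    congrFun (X3_snd_u _) _, congrFun (X3_snd_v _) _, map_add dot, map_sub dot, map_neg dot, map_smul dot,
    dot_mul, dot_two, pull_add, pull_sub, pull_neg, pull_mul, pull_smul, pull_two, pull_zero]
  refine ⟨⟨?_, ?_, ?_⟩, ?_, ?_⟩ <;> ring

lemma bracket_X3_X4 (f g : Fun) : ⁅X3 f, X4 g⁆ = X3 (-(g * dot f) - (1 / 2 : ℝ) • (f * dot g)) := by
  refine VF.ext_components fun p => ?_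
  simp (disch := fun_prop) only [bracket_fst, bracket_snd,
    X3_fst_t, X3_fst_x, X3_fst_y, X3_snd_u, X3_snd_v, X4_fst_t, X4_fst_x, X4_fst_y, X4_snd_u,
    X4_snd_v, pd_const, pd_mul, pd_add, pd_sub, pd_neg, pd_pull, pd_base, pd_fibre]
  simp only [VF.add_fst, VF.add_snd, VF.zero_fst, VF.zero_snd,
    congrFun (X3_fst_t _) _, congrFun (X3_fst_x _) _, congrFun (X3_fst_y _) _,
    congrFun (X3_snd_u _) _, congrFun (X3_snd_v _) _, congrFun (X4_fst_t _) _,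
    congrFun (X4_fst_x _) _, congrFun (X4_fst_y _) _, congrFun (X4_snd_u _) _,
    congrFun (X4_snd_v _) _, map_add dot, map_sub dot, map_neg dot, map_smul dot, dot_mul, dot_two, pull_add,
    pull_sub, pull_neg, pull_mul, pull_smul, pull_two, pull_zero]
  refine ⟨⟨?_, ?_, ?_⟩, ?_, ?_⟩ <;> ring

lemma bracket_X3_X5 (f g : Fun) : ⁅X3 f, X5 g⁆ = X3 (f * g) := by
  refine VF.ext_components fun p => ?_
  simp (disch := fun_prop) only [bracket_fst, bracket_snd,
    X3_fst_t, X3_fst_x, X3_fst_y, X3_snd_u, X3_snd_v, X5_fst_t, X5_fst_x, X5_fst_y, X5_snd_u,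
    X5_snd_v, pd_const, pd_mul, pd_add, pd_sub, pd_neg, pd_pull, pd_base, pd_fibre]
  simp only [VF.add_fst, VF.add_snd, VF.zero_fst, VF.zero_snd,
    congrFun (X3_fst_t _) _, congrFun (X3_fst_x _) _, congrFun (X3_fst_y _) _,
    congrFun (X3_snd_u _) _, congrFun (X3_snd_v _) _, congrFun (X5_fst_t _) _,
    congrFun (X5_fst_x _) _, congrFun (X5_fst_y _) _, congrFun (X5_snd_u _) _,
    congrFun (X5_snd_v _) _, map_add dot, map_sub dot, map_neg dot, map_smul dot, dot_mul, dot_two, pull_add,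
    pull_sub, pull_neg, pull_mul, pull_smul, pull_two, pull_zero]
  refine ⟨⟨?_, ?_, ?_⟩, ?_, ?_⟩ <;> ring

lemma bracket_X4_X4 (f g : Fun) : ⁅X4 f, X4 g⁆ = X4 (f * dot g - g * dot f) := by
  refine VF.ext_components fun p => ?_
  simp (disch := fun_prop) only [bracket_fst, bracket_snd,
    X4_fst_t, X4_fst_x, X4_fst_y, X4_snd_u, X4_snd_v, pd_const, pd_mul, pd_add, pd_sub, pd_neg,
    pd_pull, pd_base, pd_fibre]
  simp only [VF.add_fst, VF.add_snd, VF.zero_fst, VF.zero_snd,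
    congrFun (X4_fst_t _) _, congrFun (X4_fst_x _) _, congrFun (X4_fst_y _) _,
    congrFun (X4_snd_u _) _, congrFun (X4_snd_v _) _, map_add dot, map_sub dot, map_neg dot, map_smul dot,
    dot_mul, dot_two, pull_add, pull_sub, pull_neg, pull_mul, pull_smul, pull_two, pull_zero]
  -- Simplification has already reduced the ∂_t-component to `True`.
  refine ⟨⟨trivial, ?_, ?_⟩, ?_, ?_⟩ <;> ring

lemma bracket_X4_X5 (f g : Fun) : ⁅X4 f, X5 g⁆ = X5 (f * dot g) := by
  refine VF.ext_components fun p => ?_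
  simp (disch := fun_prop) only [bracket_fst, bracket_snd,
    X4_fst_t, X4_fst_x, X4_fst_y, X4_snd_u, X4_snd_v, X5_fst_t, X5_fst_x, X5_fst_y, X5_snd_u,
    X5_snd_v, pd_const, pd_mul, pd_add, pd_sub, pd_neg, pd_pull, pd_base, pd_fibre]
  simp only [VF.add_fst, VF.add_snd, VF.zero_fst, VF.zero_snd,
    congrFun (X4_fst_t _) _, congrFun (X4_fst_x _) _, congrFun (X4_fst_y _) _,
    congrFun (X4_snd_u _) _, congrFun (X4_snd_v _) _, congrFun (X5_fst_t _) _,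
    congrFun (X5_fst_x _) _, congrFun (X5_fst_y _) _, congrFun (X5_snd_u _) _,
    congrFun (X5_snd_v _) _, map_add dot, map_sub dot, map_neg dot, map_smul dot, dot_mul, dot_two, pull_add,
    pull_sub, pull_neg, pull_mul, pull_smul, pull_two, pull_zero]
  refine ⟨⟨?_, ?_, ?_⟩, ?_, ?_⟩ <;> ring

lemma bracket_X5_X5 (f g : Fun) : ⁅X5 f, X5 g⁆ = 0 := by
  refine VF.ext_components fun p => ?_
  simp (disch := fun_prop) only [bracket_fst, bracket_snd,
    X5_fst_t, X5_fst_x, X5_fst_y, X5_snd_u, X5_snd_v, pd_const, pd_mul, pd_add, pd_sub,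
    pd_pull, pd_base, pd_fibre]
  simp only [VF.zero_fst, VF.zero_snd, congrFun (X5_fst_t _) _, congrFun (X5_fst_x _) _,
    congrFun (X5_fst_y _) _, congrFun (X5_snd_u _) _, congrFun (X5_snd_v _) _]
  refine ⟨⟨?_, ?_, ?_⟩, ?_, ?_⟩ <;> ring

/-! ### Lie algebra structure, span and perfectness -/

/-- Antisymmetry is specialized to pairs of families in decreasing order, so that it is a
terminating rewrite towards the entries of the table. -/
lemma lie_skew_X2_X1 (f g : Fun) : ⁅X2 f, X1 g⁆ = -⁅X1 g, X2 f⁆ := (lie_skew _ _).symm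
lemma lie_skew_X3_X1 (f g : Fun) : ⁅X3 f, X1 g⁆ = -⁅X1 g, X3 f⁆ := (lie_skew _ _).symm
lemma lie_skew_X4_X1 (f g : Fun) : ⁅X4 f, X1 g⁆ = -⁅X1 g, X4 f⁆ := (lie_skew _ _).symm
lemma lie_skew_X5_X1 (f g : Fun) : ⁅X5 f, X1 g⁆ = -⁅X1 g, X5 f⁆ := (lie_skew _ _).symm
lemma lie_skew_X3_X2 (f g : Fun) : ⁅X3 f, X2 g⁆ = -⁅X2 g, X3 f⁆ := (lie_skew _ _).symm
lemma lie_skew_X4_X2 (f g : Fun) : ⁅X4 f, X2 g⁆ = -⁅X2 g, X4 f⁆ := (lie_skew _ _).symm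
lemma lie_skew_X5_X2 (f g : Fun) : ⁅X5 f, X2 g⁆ = -⁅X2 g, X5 f⁆ := (lie_skew _ _).symm
lemma lie_skew_X4_X3 (f g : Fun) : ⁅X4 f, X3 g⁆ = -⁅X3 g, X4 f⁆ := (lie_skew _ _).symm
lemma lie_skew_X5_X3 (f g : Fun) : ⁅X5 f, X3 g⁆ = -⁅X3 g, X5 f⁆ := (lie_skew _ _).symm
lemma lie_skew_X5_X4 (f g : Fun) : ⁅X5 f, X4 g⁆ = -⁅X4 g, X5 f⁆ := (lie_skew _ _).symm

/-- The Lie algebra of point symmetries. -/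
def symmetryAlgebra : LieSubalgebra ℝ VF where
  toSubmodule := symmetries
  lie_mem' {X Y} hX hY := by
    change ⁅X, Y⁆ ∈ symmetries
    -- Closure is checked on the spanning families through the table, so compatibility of
    -- prolongation with brackets is not needed.
    obtain ⟨a, b, c, d, e, rfl⟩ := exists_eq_of_mem_symmetries hX
    obtain ⟨a', b', c', d', e', rfl⟩ := exists_eq_of_mem_symmetries hY
    simp only [add_lie, lie_add, neg_add,
      lie_skew_X2_X1, lie_skew_X3_X1, lie_skew_X4_X1, lie_skew_X5_X1, lie_skew_X3_X2,
      lie_skew_X4_X2, lie_skew_X5_X2, lie_skew_X4_X3, lie_skew_X5_X3, lie_skew_X5_X4,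
      bracket_X1_X1, bracket_X1_X2, bracket_X1_X3, bracket_X1_X4, bracket_X1_X5, bracket_X2_X2,
      bracket_X2_X3, bracket_X2_X4, bracket_X2_X5, bracket_X3_X3, bracket_X3_X4, bracket_X3_X5,
      bracket_X4_X4, bracket_X4_X5, bracket_X5_X5]
    repeat' apply add_mem
    all_goals simp only [neg_mem_iff, zero_mem, X1_mem, X2_mem, X3_mem, X4_mem, X5_mem]

lemma mem_symmetryAlgebra {X : VF} : X ∈ symmetryAlgebra ↔ IsPointSymmetry X.1 := Iff.rfl

lemma symmetries_eq : symmetries = LinearMap.range X1 ⊔ LinearMap.range X2 ⊔ LinearMap.range X3 ⊔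
    LinearMap.range X4 ⊔ LinearMap.range X5 := by
  apply le_antisymm
  · intro X hX
    obtain ⟨a, b, c, d, e, rfl⟩ := exists_eq_of_mem_symmetries hX
    exact Submodule.add_mem_sup (Submodule.add_mem_sup (Submodule.add_mem_sup
      (Submodule.add_mem_sup ⟨a, rfl⟩ ⟨b, rfl⟩) ⟨c, rfl⟩) ⟨d, rfl⟩) ⟨e, rfl⟩
  · refine sup_le (sup_le (sup_le (sup_le ?_ ?_) ?_) ?_) ?_ <;> rintro _ ⟨f, rfl⟩
    exacts [X1_mem f, X2_mem f, X3_mem f, X4_mem f, X5_mem f]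

lemma symmetryAlgebra_perfect :
    ⁅(⊤ : LieIdeal ℝ symmetryAlgebra), (⊤ : LieIdeal ℝ symmetryAlgebra)⁆ = ⊤ := by
  have key : ∀ (A B Z : VF) (_ : A ∈ symmetries) (_ : B ∈ symmetries) (hZ : Z ∈ symmetries)
      (_ : ⁅A, B⁆ = Z), (⟨Z, hZ⟩ : symmetryAlgebra) ∈
        ⁅(⊤ : LieIdeal ℝ symmetryAlgebra), (⊤ : LieIdeal ℝ symmetryAlgebra)⁆ := by
    rintro A B _ hA hB hZ rfl
    exact LieSubmodule.lie_mem_lie (x := (⟨A, hA⟩ : symmetryAlgebra))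
      (m := (⟨B, hB⟩ : symmetryAlgebra)) (LieSubmodule.mem_top _) (LieSubmodule.mem_top _)
  rw [eq_top_iff]
  rintro ⟨X, hX⟩ -
  obtain ⟨a, b, c, d, e, rfl⟩ := exists_eq_of_mem_symmetries hX
  -- Bracketing with `X4 1` differentiates the parameter of `X4` and `X5`, so antiderivatives are
  -- needed for these two. The other families arise undifferentiated from brackets with `X2 1` or
  -- `X5 1`.
  obtain ⟨D, rfl⟩ := dot_surjective d
  obtain ⟨G, rfl⟩ := dot_surjective e
  exact add_mem (add_mem (add_mem (add_mem
    (key (X2 1) (X3 a) _ (X2_mem _) (X3_mem _) (X1_mem a) (by rw [bracket_X2_X3, one_mul]))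
    (key (X2 b) (X5 1) _ (X2_mem _) (X5_mem _) (X2_mem b)
      (by rw [bracket_X2_X5, dot_one, mul_one, mul_zero, map_zero, add_zero])))
    (key (X3 c) (X5 1) _ (X3_mem _) (X5_mem _) (X3_mem c) (by rw [bracket_X3_X5, mul_one])))
    (key (X4 1) (X4 D) _ (X4_mem _) (X4_mem _) (X4_mem _)
      (by rw [bracket_X4_X4, dot_one, one_mul, mul_zero, sub_zero])))
    (key (X4 1) (X5 G) _ (X4_mem _) (X5_mem _) (X5_mem _) (by rw [bracket_X4_X5, one_mul]))

/-! ### The grading -/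

lemma X1_mem_gradedPart (f : Fun) : X1 f ∈ gradedPart 2 := ⟨f, rfl⟩
lemma X2_mem_gradedPart (f : Fun) : X2 f ∈ gradedPart 1 := Submodule.mem_sup_left ⟨f, rfl⟩
lemma X3_mem_gradedPart (f : Fun) : X3 f ∈ gradedPart 1 := Submodule.mem_sup_right ⟨f, rfl⟩
lemma X4_mem_gradedPart (f : Fun) : X4 f ∈ gradedPart 0 := Submodule.mem_sup_left ⟨f, rfl⟩
lemma X5_mem_gradedPart (f : Fun) : X5 f ∈ gradedPart 0 := Submodule.mem_sup_right ⟨f, rfl⟩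

lemma exists_eq_of_mem_gradedPart {i : ℤ} {X : VF} (hX : X ∈ gradedPart i) :
    (i = 0 ∧ ∃ d e, X = X4 d + X5 e) ∨ (i = 1 ∧ ∃ b c, X = X2 b + X3 c) ∨
      (i = 2 ∧ ∃ a, X = X1 a) ∨ X = 0 := by
  unfold gradedPart at hX
  split_ifs at hX with h0 h1 h2
  · obtain ⟨_, ⟨d, rfl⟩, _, ⟨e, rfl⟩, rfl⟩ := Submodule.mem_sup.1 hX
    exact Or.inl ⟨h0, d, e, rfl⟩
  · obtain ⟨_, ⟨b, rfl⟩, _, ⟨c, rfl⟩, rfl⟩ := Submodule.mem_sup.1 hX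
    exact Or.inr (Or.inl ⟨h1, b, c, rfl⟩)
  · obtain ⟨a, rfl⟩ := hX
    exact Or.inr (Or.inr (Or.inl ⟨h2, a, rfl⟩))
  · exact Or.inr (Or.inr (Or.inr ((Submodule.mem_bot ℝ).1 hX)))

lemma lie_mem_gradedPart {i j : ℤ} {X Y : VF} (hX : X ∈ gradedPart i) (hY : Y ∈ gradedPart j) :
    ⁅X, Y⁆ ∈ gradedPart (i + j) := by
  have e11 : (1 : ℤ) + 1 = 2 := rfl
  rcases exists_eq_of_mem_gradedPart hX with ⟨rfl, d, e, rfl⟩ | ⟨rfl, b, c, rfl⟩ | ⟨rfl, a, rfl⟩ | rfl <;>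
    rcases exists_eq_of_mem_gradedPart hY with
      ⟨rfl, d', e', rfl⟩ | ⟨rfl, b', c', rfl⟩ | ⟨rfl, a', rfl⟩ | rfl <;>
    simp only [add_lie, lie_add, zero_lie, lie_zero, add_zero, zero_add, neg_zero, neg_add, e11,
      lie_skew_X2_X1, lie_skew_X3_X1, lie_skew_X4_X1, lie_skew_X5_X1, lie_skew_X3_X2,
      lie_skew_X4_X2, lie_skew_X5_X2, lie_skew_X4_X3, lie_skew_X5_X3, lie_skew_X5_X4,
      bracket_X1_X1, bracket_X1_X2, bracket_X1_X3, bracket_X1_X4, bracket_X1_X5, bracket_X2_X2,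
      bracket_X2_X3, bracket_X2_X4, bracket_X2_X5, bracket_X3_X3, bracket_X3_X4, bracket_X3_X5,
      bracket_X4_X4, bracket_X4_X5, bracket_X5_X5]
  all_goals
    repeat' apply add_mem
  all_goals
    simp only [neg_mem_iff, zero_mem, X1_mem_gradedPart, X2_mem_gradedPart,
      X3_mem_gradedPart, X4_mem_gradedPart, X5_mem_gradedPart]

/-- The grading is the eigenspace decomposition of `ad (X₅ 1)`. -/
lemma lie_X5_one_of_mem_gradedPart {i : ℤ} {X : VF} (hX : X ∈ gradedPart i) :
    ⁅X5 1, X⁆ = (-(i : ℝ)) • X := by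
  rw [← lie_skew]
  rcases exists_eq_of_mem_gradedPart hX with ⟨rfl, d, e, rfl⟩ | ⟨rfl, b, c, rfl⟩ | ⟨rfl, a, rfl⟩ | rfl
  · simp [add_lie, bracket_X4_X5, bracket_X5_X5, dot_one]
  · simp [add_lie, bracket_X2_X5, bracket_X3_X5, dot_one, add_comm]
  · simp only [bracket_X1_X5, mul_one, two_mul, map_add, Int.cast_ofNat]
    module
  · simp

lemma gradedPart_isInternal : DirectSum.IsInternal
    (fun i : ℤ => (gradedPart i).comap (symmetryAlgebra.incl : symmetryAlgebra →ₗ[ℝ] VF)) := by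
  rw [DirectSum.isInternal_submodule_iff_iSupIndep_and_iSup_eq_top]
  constructor
  -- Different degrees give different eigenvalues of ad `X5 1`, so independence of the graded parts
  -- is inherited from independence of its eigenspaces.
  · have hinj : Function.Injective fun i : ℤ => -(i : ℝ) := fun i j h => by
      simpa using h
    refine ((Module.End.eigenspaces_iSupIndep
      (LieAlgebra.ad ℝ symmetryAlgebra ⟨X5 1, X5_mem 1⟩)).comp hinj).mono fun i X hX => ?_
    rw [Function.comp_apply, Module.End.mem_eigenspace_iff]
    exact Subtype.ext (lie_X5_one_of_mem_gradedPart hX)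
  · rw [eq_top_iff]
    rintro ⟨X, hX⟩ -
    obtain ⟨a, b, c, d, e, rfl⟩ := exists_eq_of_mem_symmetries hX
    have key : ∀ (i : ℤ) (Z : VF) (hZ : Z ∈ symmetries), Z ∈ gradedPart i →
        (⟨Z, hZ⟩ : symmetryAlgebra) ∈ ⨆ i : ℤ,
          (gradedPart i).comap (symmetryAlgebra.incl : symmetryAlgebra →ₗ[ℝ] VF) :=
      fun i Z _ h => Submodule.mem_iSup_of_mem i h
    exact add_mem (add_mem (add_mem (add_mem
      (key 2 _ (X1_mem a) (X1_mem_gradedPart a)) (key 1 _ (X2_mem b) (X2_mem_gradedPart b)))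
      (key 1 _ (X3_mem c) (X3_mem_gradedPart c))) (key 0 _ (X4_mem d) (X4_mem_gradedPart d)))
      (key 0 _ (X5_mem e) (X5_mem_gradedPart e))

end ManakovSantini

end

theorem theorem1 :
    ∃ sym : LieSubalgebra ℝ VF,
      -- `sym` consists of exactly the point symmetries
      (∀ X : VF, X ∈ sym ↔ IsPointSymmetry X.1) ∧
      -- it is spanned by the five families
      sym.toSubmodule = LinearMap.range X1 ⊔ LinearMap.range X2 ⊔ LinearMap.range X3 ⊔
        LinearMap.range X4 ⊔ LinearMap.range X5 ∧
      -- the commutation relations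
      (∀ f g : Fun,
        ⁅X1 f, X1 g⁆ = 0 ∧
        ⁅X1 f, X2 g⁆ = 0 ∧
        ⁅X1 f, X3 g⁆ = 0 ∧
        ⁅X1 f, X4 g⁆ = X1 (-(g * dot f)) ∧
        ⁅X1 f, X5 g⁆ = X1 (2 * f * g) ∧
        ⁅X2 f, X2 g⁆ = 0 ∧
        ⁅X2 f, X3 g⁆ = X1 (f * g) ∧
        ⁅X2 f, X4 g⁆ = X2 ((1 / 2 : ℝ) • (f * dot g) - g * dot f) ∧
        ⁅X2 f, X5 g⁆ = X2 (f * g) + X3 (2 * f * dot g) ∧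
        ⁅X3 f, X3 g⁆ = 0 ∧
        ⁅X3 f, X4 g⁆ = X3 (-(g * dot f) - (1 / 2 : ℝ) • (f * dot g)) ∧
        ⁅X3 f, X5 g⁆ = X3 (f * g) ∧
        ⁅X4 f, X4 g⁆ = X4 (f * dot g - g * dot f) ∧
        ⁅X4 f, X5 g⁆ = X5 (f * dot g) ∧
        ⁅X5 f, X5 g⁆ = 0) ∧
      -- `sym` is perfect
      ⁅(⊤ : LieIdeal ℝ sym), (⊤ : LieIdeal ℝ sym)⁆ = ⊤ ∧
      -- `sym` is graded
      DirectSum.IsInternal (fun i : ℤ => (gradedPart i).comap (sym.incl : sym →ₗ[ℝ] VF)) ∧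
      SetLike.GradedBracket (fun i : ℤ => (gradedPart i).comap (sym.incl : sym →ₗ[ℝ] VF)) := by
  refine ⟨symmetryAlgebra, fun X => mem_symmetryAlgebra, symmetries_eq, fun f g => ?_,
    symmetryAlgebra_perfect, gradedPart_isInternal, ⟨fun i j X Y hX hY => ?_⟩⟩
  · exact ⟨bracket_X1_X1 f g, bracket_X1_X2 f g, bracket_X1_X3 f g, bracket_X1_X4 f g,
      bracket_X1_X5 f g, bracket_X2_X2 f g, bracket_X2_X3 f g, bracket_X2_X4 f g,
      bracket_X2_X5 f g, bracket_X3_X3 f g, bracket_X3_X4 f g, bracket_X3_X5 f g,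
      bracket_X4_X4 f g, bracket_X4_X5 f g, bracket_X5_X5 f g⟩
  · exact lie_mem_gradedPart hX hY
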